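/- Let $D^{2,2,2}$ be the modular lattice with unity $I$ presented by the generators $x_1,y_1,x_2,y_2,x_3,y_3$ and the relations $x_i\subseteq y_i$ $(i=1,2,3)$; sum and intersection are written $a+b$ and $ab$. *Atomic elements.* For $\{i,j,k\}=\{1,2,3\}$ put $a_0^{ij}=A_0^{ij}=I$ and, for $n\ge 1$, $a_n^{ij}=x_i+y_j\,a_{n-1}^{jk}$, $\;A_n^{ij}=y_i+x_j\,A_{n-1}^{ki}$. *Admissible elements.* To the following index sequences $\alpha$ with rightmost index $1$ associate elements $f_\alpha\subseteq e_\alpha$. Here $\gamma=(213)^{2p}(21)^{2k}$ with $k>0,\ p\ge 0$, $\;\beta=(213)^{2p}(21)^{2k+1}$ with $k,p\ge 0$, in types 7 and 8 $k\ge 0$, and $q=k+3p$. $$\begin{array}{r|l|l|l} & \alpha & f_\alpha & e_\alpha\\ \hline 1&\gamma & y_1y_2a^{13}_qA^{32}_{k-1} & y_2A^{32}_{k-1}a^{21}_qA^{13}_ka^{13}_q\\ 2&3\gamma & y_3(x_1+x_2)A^{23}_qa^{31}_{k-1} & y_3a^{31}_{k-1}A^{12}_{q+1}a^{12}_kA^{23}_q\\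 3&13\gamma & y_3y_1a^{32}_{q+1}A^{21}_{k-1} & y_1A^{21}_{k-1}a^{13}_{q+1}A^{32}_ka^{32}_{q+1}\\ 4&(213)\gamma & y_2(x_3+x_1)A^{12}_{q+1}a^{23}_{k-1} & y_2a^{23}_{k-1}A^{31}_{q+2}a^{31}_kA^{12}_{q+1}\\ 5&3(213)\gamma & y_2y_3a^{21}_{q+2}A^{13}_{k-1} & y_3A^{13}_{k-1}a^{32}_{q+2}A^{21}_ka^{21}_{q+2}\\ 6&13(213)\gamma & y_1(x_2+x_3)A^{31}_{q+2}a^{12}_{k-1} & y_1a^{12}_{k-1}A^{23}_{q+3}a^{23}_kA^{31}_{q+2}\\ 7&1(21)^{2k} & x_1A^{23}_ka^{23}_k & y_1A^{31}_ka^{12}_kA^{23}_ka^{23}_k\\ 8&1(21)^{2k+1} & y_1(x_2+x_3)A^{31}_ka^{12}_k & y_1A^{31}_ka^{12}_kA^{23}_{k+1}a^{23}_{k+1}\\ 9&\beta & y_2y_3a^{21}_qA^{13}_k & y_2A^{32}_ka^{21}_qA^{13}_ka^{13}_{q+1}\\ 10&3\beta & x_3A^{12}_{q+1}a^{12}_k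 & y_3a^{31}_kA^{12}_{q+1}a^{12}_kA^{23}_{q+1}\\ 11&13\beta & y_1y_2a^{13}_{q+1}A^{32}_k & y_1A^{21}_ka^{13}_{q+1}A^{32}_ka^{32}_{q+2}\\ 12&(213)\beta & x_2A^{31}_{q+2}a^{31}_k & y_2a^{23}_kA^{31}_{q+2}a^{31}_kA^{12}_{q+2}\\ 13&3(213)\beta & y_3y_1a^{32}_{q+2}A^{21}_k & y_3A^{13}_ka^{32}_{q+2}A^{21}_ka^{21}_{q+3}\\ 14&13(213)\beta & x_1A^{23}_{q+3}a^{23}_k & y_1a^{12}_kA^{23}_{q+3}a^{23}_kA^{31}_{q+3} \end{array}$$ The remaining admissible sequences and their elements arise from these by permuting the indices $1,2,3$ simultaneously in $\alpha$ and in the polynomials. *Cumulative elements.* For $n\ge 1$ and $t=1,2,3$, let $x_t(n)=\sum f_\alpha$ and $y_t(n)=\sum e_\alpha$, the sums over all these admissible sequences $\alpha$ of length $n$ with rightmost index $t$. *The lattices $H^+(n)$.* For $\{i,j,k\}=\{1,2,3\}$ put $$a_i(0)=y_j+y_k,\qquad b_i(0)=x_i+y_j+y_k,\qquad c_i(0)=y_1+y_2+y_3,$$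 and, for $n\ge 1$, $$a_i(n)=x_j(n)+x_k(n)+y_j(n+1)+y_k(n+1),\quad b_i(n)=a_i(n)+x_i(n+1),\quad c_i(n)=a_i(n)+y_i(n+1).$$ Let $H^+(0)$ be the sublattice of $D^{2,2,2}$ generated by the elements $a_i(0)\subseteq b_i(0)$ $(i=1,2,3)$, and for $n\ge 1$ let $H^+(n)$ be the sublattice generated by the elements $a_i(n)\subseteq b_i(n)\subseteq c_i(n)$ $(i=1,2,3)$. Put $I_n=a_1(n)+a_2(n)+a_3(n)$. **Statement.** 1. $H^+(n)$ is a distributive lattice for every $n\ge 0$. 2. For every $n\ge 1$, $H^+(n)$ has exactly $64$ elements. For each $i$ the chain $a_i(n)\subset b_i(n)\subset c_i(n)\subset I_n$ has four distinct elements, and $H^+(n)$ is the direct product of these three $4$-element chains: $(v_1,v_2,v_3)\mapsto v_1v_2v_3$ is a lattice isomorphism from the product of the chains onto $H^+(n)$. 3. $H^+(0)$ has exactly $27$ elements. For each $i$ the chain $a_i(0)\subset b_i(0)\subset c_i(0)$ has three distinct elements, and $(v_1,v_2,v_3)\mapsto v_1v_2v_3$ is a lattice isomorphism from the product of these three chains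 onto $H^+(0)$. -/

import Mathlib

/-! The modular lattice `D^{2,2,2}`: the modular lattice with unity `I = ⊤` that is presented by the
generators `x_i`, `y_i` and the relations `x_i ⊆ y_i`, for `i = 1, 2, 3`.  The index set `{1, 2, 3}`
is `Fin 3`.  Sum and intersection are `⊔` and `⊓`. -/

namespace D222

/-- Lattice polynomials in `x_i`, `y_i` and the unity. -/
inductive Poly : Type
  | x : Fin 3 → Poly
  | y : Fin 3 → Poly
  | one : Poly
  | sum : Poly → Poly → Poly
  | inter : Poly → Poly → Poly

/-- The inclusions between polynomials that follow from the axioms of modular lattices with unity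
and from `x_i ⊆ y_i`. -/
inductive Poly.Le : Poly → Poly → Prop
  | refl (s : Poly) : Poly.Le s s
  | trans {s t u : Poly} : Poly.Le s t → Poly.Le t u → Poly.Le s u
  | left_sum (s t : Poly) : Poly.Le s (.sum s t)
  | right_sum (s t : Poly) : Poly.Le t (.sum s t)
  | sum_le {s t u : Poly} : Poly.Le s u → Poly.Le t u → Poly.Le (.sum s t) u
  | inter_left (s t : Poly) : Poly.Le (.inter s t) s
  | inter_right (s t : Poly) : Poly.Le (.inter s t) t
  | le_inter {s t u : Poly} : Poly.Le s t → Poly.Le s u → Poly.Le s (.inter t u)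
  | le_one (s : Poly) : Poly.Le s .one
  | modular {s u : Poly} (t : Poly) : Poly.Le s u →
      Poly.Le (.inter (.sum s t) u) (.sum s (.inter t u))
  | x_le_y (i : Fin 3) : Poly.Le (.x i) (.y i)

/-- Two polynomials are identified if each is included in the other. -/
instance polySetoid : Setoid Poly where
  r s t := Poly.Le s t ∧ Poly.Le t s
  iseqv :=
    { refl := fun s => ⟨.refl s, .refl s⟩
      symm := fun h => ⟨h.2, h.1⟩
      trans := fun h h' => ⟨h.1.trans h'.1, h'.2.trans h.2⟩ }

end D222

/-- The modular lattice `D^{2,2,2}`. -/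
def D222 : Type := Quotient D222.polySetoid

namespace D222

instance : Lattice D222 where
  le := Quotient.lift₂ Poly.Le fun _ _ _ _ h h' =>
    propext ⟨fun k => (h.2.trans k).trans h'.1, fun k => (h.1.trans k).trans h'.2⟩
  le_refl := by rintro ⟨s⟩; exact Poly.Le.refl s
  le_trans := by rintro ⟨s⟩ ⟨t⟩ ⟨u⟩ h h'; exact Poly.Le.trans h h'
  le_antisymm := by rintro ⟨s⟩ ⟨t⟩ h h'; exact Quotient.sound ⟨h, h'⟩
  sup := Quotient.map₂ Poly.sum fun s t h s' t' h' =>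
    ⟨.sum_le (h.1.trans (.left_sum t t')) (h'.1.trans (.right_sum t t')),
      .sum_le (h.2.trans (.left_sum s s')) (h'.2.trans (.right_sum s s'))⟩
  le_sup_left := by rintro ⟨s⟩ ⟨t⟩; exact Poly.Le.left_sum s t
  le_sup_right := by rintro ⟨s⟩ ⟨t⟩; exact Poly.Le.right_sum s t
  sup_le := by rintro ⟨s⟩ ⟨t⟩ ⟨u⟩ h h'; exact Poly.Le.sum_le h h'
  inf := Quotient.map₂ Poly.inter fun s t h s' t' h' =>
    ⟨.le_inter ((Poly.Le.inter_left s s').trans h.1) ((Poly.Le.inter_right s s').trans h'.1),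
      .le_inter ((Poly.Le.inter_left t t').trans h.2) ((Poly.Le.inter_right t t').trans h'.2)⟩
  inf_le_left := by rintro ⟨s⟩ ⟨t⟩; exact Poly.Le.inter_left s t
  inf_le_right := by rintro ⟨s⟩ ⟨t⟩; exact Poly.Le.inter_right s t
  le_inf := by rintro ⟨s⟩ ⟨t⟩ ⟨u⟩ h h'; exact Poly.Le.le_inter h h'

instance : IsModularLattice D222 where
  sup_inf_le_assoc_of_le := by
    rintro ⟨s⟩ ⟨t⟩ ⟨u⟩ h
    exact Poly.Le.modular t h

instance : OrderTop D222 where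
  top := Quotient.mk _ Poly.one
  le_top := by rintro ⟨s⟩; exact Poly.Le.le_one s

/-- The generators `x_i`. -/
def x (i : Fin 3) : D222 := Quotient.mk _ (Poly.x i)

/-- The generators `y_i`. -/
def y (i : Fin 3) : D222 := Quotient.mk _ (Poly.y i)

theorem x_le_y (i : Fin 3) : x i ≤ y i := Poly.Le.x_le_y i

/-- `x_1 x_2 x_3` is the least element, because it lies below every generator.  This is only used in
order to write finite sums as `Finset.sup`; all the sums below are over nonempty sets. -/
instance : OrderBot D222 where
  bot := x 0 ⊓ x 1 ⊓ x 2
  bot_le := by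
    have hx : ∀ i, x 0 ⊓ x 1 ⊓ x 2 ≤ x i := by
      intro i
      fin_cases i
      · exact inf_le_left.trans inf_le_left
      · exact inf_le_left.trans inf_le_right
      · exact inf_le_right
    rintro ⟨s⟩
    induction s with
    | x i => exact hx i
    | y i => exact (hx i).trans (x_le_y i)
    | one => exact le_top
    | sum s t hs ht => exact Poly.Le.trans hs (Poly.Le.left_sum s t)
    | inter s t hs ht => exact Poly.Le.le_inter hs ht

/-- For distinct `i`, `j`, the index `k` such that `{i, j, k}` is the whole index set. -/
def third (i j : Fin 3) : Fin 3 := -(i + j)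

/-- The atomic elements `a_n^{ij}`: `a_0^{ij} = I` and `a_n^{ij} = x_i + y_j a_{n-1}^{jk}`. -/
def a : ℕ → Fin 3 → Fin 3 → D222
  | 0, _, _ => ⊤
  | n + 1, i, j => x i ⊔ y j ⊓ a n j (third i j)

/-- The atomic elements `A_n^{ij}`: `A_0^{ij} = I` and `A_n^{ij} = y_i + x_j A_{n-1}^{ki}`. -/
def A : ℕ → Fin 3 → Fin 3 → D222
  | 0, _, _ => ⊤
  | n + 1, i, j => y i ⊔ x j ⊓ A n (third i j) i

/-- `w` repeated `m` times. -/
def rep (m : ℕ) (w : List (Fin 3)) : List (Fin 3) := (List.replicate m w).flatten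

/-- The sequence `γ = (jil)^{2p} (ji)^{2k}`, which is `(213)^{2p} (21)^{2k}` for `i, j, l = 1, 2, 3`. -/
def gam (i j l : Fin 3) (k p : ℕ) : List (Fin 3) := rep (2 * p) [j, i, l] ++ rep (2 * k) [j, i]

/-- The sequence `β = (jil)^{2p} (ji)^{2k+1}`, which is `(213)^{2p} (21)^{2k+1}` for
`i, j, l = 1, 2, 3`. -/
def bet (i j l : Fin 3) (k p : ℕ) : List (Fin 3) := rep (2 * p) [j, i, l] ++ rep (2 * k + 1) [j, i]

/-- The fourteen types of admissible sequences that start (at the right end) with `i`; the indices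
`1, 2, 3` of the table are replaced by `i, j, l`. -/
def adm (i j l : Fin 3) (k p : ℕ) : Fin 14 → List (Fin 3) :=
  ![gam i j l k p,
    l :: gam i j l k p,
    i :: l :: gam i j l k p,
    j :: i :: l :: gam i j l k p,
    l :: j :: i :: l :: gam i j l k p,
    i :: l :: j :: i :: l :: gam i j l k p,
    i :: rep (2 * k) [j, i],
    i :: rep (2 * k + 1) [j, i],
    bet i j l k p,
    l :: bet i j l k p,
    i :: l :: bet i j l k p,
    j :: i :: l :: bet i j l k p,
    l :: j :: i :: l :: bet i j l k p,
    i :: l :: j :: i :: l :: bet i j l k p]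

/-- The admissible elements `f_α`, for `α = adm i j l k p r`; here `q = k + 3 p`. -/
def f (i j l : Fin 3) (k p : ℕ) : Fin 14 → D222 :=
  let q := k + 3 * p
  ![y i ⊓ y j ⊓ a q i l ⊓ A (k - 1) l j,
    y l ⊓ (x i ⊔ x j) ⊓ A q j l ⊓ a (k - 1) l i,
    y l ⊓ y i ⊓ a (q + 1) l j ⊓ A (k - 1) j i,
    y j ⊓ (x l ⊔ x i) ⊓ A (q + 1) i j ⊓ a (k - 1) j l,
    y j ⊓ y l ⊓ a (q + 2) j i ⊓ A (k - 1) i l,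
    y i ⊓ (x j ⊔ x l) ⊓ A (q + 2) l i ⊓ a (k - 1) i j,
    x i ⊓ A k j l ⊓ a k j l,
    y i ⊓ (x j ⊔ x l) ⊓ A k l i ⊓ a k i j,
    y j ⊓ y l ⊓ a q j i ⊓ A k i l,
    x l ⊓ A (q + 1) i j ⊓ a k i j,
    y i ⊓ y j ⊓ a (q + 1) i l ⊓ A k l j,
    x j ⊓ A (q + 2) l i ⊓ a k l i,
    y l ⊓ y i ⊓ a (q + 2) l j ⊓ A k j i,
    x i ⊓ A (q + 3) j l ⊓ a k j l]

/-- The admissible elements `e_α`, for `α = adm i j l k p r`; here `q = k + 3 p`. -/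
def e (i j l : Fin 3) (k p : ℕ) : Fin 14 → D222 :=
  let q := k + 3 * p
  ![y j ⊓ A (k - 1) l j ⊓ a q j i ⊓ A k i l ⊓ a q i l,
    y l ⊓ a (k - 1) l i ⊓ A (q + 1) i j ⊓ a k i j ⊓ A q j l,
    y i ⊓ A (k - 1) j i ⊓ a (q + 1) i l ⊓ A k l j ⊓ a (q + 1) l j,
    y j ⊓ a (k - 1) j l ⊓ A (q + 2) l i ⊓ a k l i ⊓ A (q + 1) i j,
    y l ⊓ A (k - 1) i l ⊓ a (q + 2) l j ⊓ A k j i ⊓ a (q + 2) j i,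
    y i ⊓ a (k - 1) i j ⊓ A (q + 3) j l ⊓ a k j l ⊓ A (q + 2) l i,
    y i ⊓ A k l i ⊓ a k i j ⊓ A k j l ⊓ a k j l,
    y i ⊓ A k l i ⊓ a k i j ⊓ A (k + 1) j l ⊓ a (k + 1) j l,
    y j ⊓ A k l j ⊓ a q j i ⊓ A k i l ⊓ a (q + 1) i l,
    y l ⊓ a k l i ⊓ A (q + 1) i j ⊓ a k i j ⊓ A (q + 1) j l,
    y i ⊓ A k j i ⊓ a (q + 1) i l ⊓ A k l j ⊓ a (q + 2) l j,
    y j ⊓ a k j l ⊓ A (q + 2) l i ⊓ a k l i ⊓ A (q + 2) i j,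
    y l ⊓ A k i l ⊓ a (q + 2) l j ⊓ A k j i ⊓ a (q + 3) j i,
    y i ⊓ a k i j ⊓ A (q + 3) j l ⊓ a k j l ⊓ A (q + 3) l i]

/-- The parameters `(σ, r, k, p)` of the admissible sequences of length `n` that start with `t`.
The permutation `σ` of the indices has `σ(1) = t`; in the first six types `k > 0`.  The bounds on
`k` and `p` follow from the length (types 7 and 8 do not depend on `p`). -/
def params (t : Fin 3) (n : ℕ) : Finset (Equiv.Perm (Fin 3) × Fin 14 × ℕ × ℕ) :=
  (Finset.univ ×ˢ Finset.univ ×ˢ Finset.range (n + 1) ×ˢ Finset.range (n + 1)).filter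
    fun s => s.1 0 = t ∧ (s.2.1 < 6 → 0 < s.2.2.1) ∧
      (adm (s.1 0) (s.1 1) (s.1 2) s.2.2.1 s.2.2.2 s.2.1).length = n

/-- The cumulative elements `x_t(n)`: the sum of all `f_α` with `α` of length `n` starting with
`t`. -/
def cumX (t : Fin 3) (n : ℕ) : D222 :=
  (params t n).sup fun s => f (s.1 0) (s.1 1) (s.1 2) s.2.2.1 s.2.2.2 s.2.1

/-- The cumulative elements `y_t(n)`: the sum of all `e_α` with `α` of length `n` starting with
`t`. -/
def cumY (t : Fin 3) (n : ℕ) : D222 :=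
  (params t n).sup fun s => e (s.1 0) (s.1 1) (s.1 2) s.2.2.1 s.2.2.2 s.2.1

/-- The elements `a_i(n)`; the two indices other than `i` are `i + 1` and `i + 2` modulo 3. -/
def genA : ℕ → Fin 3 → D222
  | 0, i => y (i + 1) ⊔ y (i + 2)
  | n + 1, i => cumX (i + 1) (n + 1) ⊔ cumX (i + 2) (n + 1) ⊔
      cumY (i + 1) (n + 2) ⊔ cumY (i + 2) (n + 2)

/-- The elements `b_i(n)`. -/
def genB : ℕ → Fin 3 → D222
  | 0, i => x i ⊔ y (i + 1) ⊔ y (i + 2)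
  | n + 1, i => genA (n + 1) i ⊔ cumX i (n + 2)

/-- The elements `c_i(n)`. -/
def genC : ℕ → Fin 3 → D222
  | 0, _ => y 0 ⊔ y 1 ⊔ y 2
  | n + 1, i => genA (n + 1) i ⊔ cumY i (n + 2)

/-- The sublattice generated by a set. -/
def gen (S : Set D222) : Sublattice D222 where
  carrier := latticeClosure S
  supClosed' := isSublattice_latticeClosure.supClosed
  infClosed' := isSublattice_latticeClosure.infClosed

/-- The sublattice `H^+(n)`: generated by the chains `a_i(0) ⊆ b_i(0)` for `n = 0` and by the chains
`a_i(n) ⊆ b_i(n) ⊆ c_i(n)` for `n ≥ 1`. -/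
def H : ℕ → Sublattice D222
  | 0 => gen (Set.range (genA 0) ∪ Set.range (genB 0))
  | n + 1 => gen (Set.range (genA (n + 1)) ∪ Set.range (genB (n + 1)) ∪ Set.range (genC (n + 1)))

/-- The element `I_n = a_1(n) + a_2(n) + a_3(n)`. -/
def unit (n : ℕ) : D222 := genA n 0 ⊔ genA n 1 ⊔ genA n 2

/-- The four-term chain `a_i(n) ⊆ b_i(n) ⊆ c_i(n) ⊆ I_n`. -/
def chain4 (n : ℕ) (i : Fin 3) : Fin 4 → D222 := ![genA n i, genB n i, genC n i, unit n]

/-- The three-term chain `a_i(0) ⊆ b_i(0) ⊆ c_i(0)`. -/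
def chain3 (i : Fin 3) : Fin 3 → D222 := ![genA 0 i, genB 0 i, genC 0 i]

end D222

/-! The product structure is formal; only the strictness of the chains needs representations. Every
cumulative summand of index t lies in the two elements a_i(n) with i ≠ t, hence a_i + a_j a_l = I_n
(`genA_sup_inf`). In a modular lattice, three chains with a common top and bottoms coindependent in
this sense generate the product of the chains: the meet v_1 v_2 v_3 equals a sum of three terms,
each depending on one coordinate (`inf_eq_sup_of_coindependent`), so such meets are closed under
sums, and adding a_i to the meet recovers v_i.

The members of the chains are separated by repeated reflections of one-dimensional representations.
A reflection has the space (V/x_1 ⊕ V/x_2 ⊕ V/x_3)/V; its elementary maps φ_1, φ_2, φ_3 have sum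
zero, φ_i has kernel x_i, and it sends V onto the new y_i and y_i onto the new x_i. These maps
exchange the atomic elements a and A (`mem_a`, `mem_A`), hence carry admissible elements to
admissible elements one letter longer (`sends_fst`, `sends_snd`). So a cumulative element of
positive length that vanishes on a representation has a vanishing successor on the reflection, and
along a tower one that starts as the whole space at length 1 stays so (`map_le_cum`). The
description of the kernels needs x_i x_j = 0, and the reflections must stay nonzero; both follow
from negative defect on all subrepresentations, which reflection preserves (`Step.negative`).

On the n-th reflection of `line i b`, a_i(n) vanishes, y_i(n+1) is everything, y_i(n+2) is zero, and
x_i(n+1) is everything or zero according to b. These values give all the strict inclusions. -/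

/-! ### Products of three chains in a modular lattice -/

section ChainProduct

set_option linter.unusedSectionVars false

variable {L : Type*} [Lattice L] [IsModularLattice L] {m : ℕ}

/-- The meet `c 0 (v 0) ⊓ c 1 (v 1) ⊓ c 2 (v 2)` of members of three chains. -/
def chainMeet (c : Fin 3 → Fin (m + 1) → L) (v : Fin 3 → Fin (m + 1)) : L :=
  c 0 (v 0) ⊓ c 1 (v 1) ⊓ c 2 (v 2)

/-- By modularity c₂ is the sum of a₂ and its part below a₀ a₁. That part already lies below c₀ c₁,
so the modular law splits the meet with c₀ c₁; the same argument then splits off c₁. -/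
theorem inf_eq_sup_of_coindependent {a₀ a₁ a₂ c₀ c₁ c₂ T : L}
    (h₁ : a₁ ⊔ a₀ ⊓ a₂ = T) (h₂ : a₂ ⊔ a₀ ⊓ a₁ = T)
    (ha₀ : a₀ ≤ c₀) (ha₁ : a₁ ≤ c₁) (ha₂ : a₂ ≤ c₂) (hc₁ : c₁ ≤ T) (hc₂ : c₂ ≤ T) :
    c₀ ⊓ c₁ ⊓ c₂ = c₀ ⊓ (a₁ ⊓ a₂) ⊔ c₁ ⊓ (a₀ ⊓ a₂) ⊔ c₂ ⊓ (a₀ ⊓ a₁) := by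
  have e₁ : c₁ = c₁ ⊓ (a₀ ⊓ a₂) ⊔ a₁ := by
    rw [inf_sup_assoc_of_le _ ha₁, sup_comm, h₁, inf_eq_left.2 hc₁]
  have e₂ : c₂ = c₂ ⊓ (a₀ ⊓ a₁) ⊔ a₂ := by
    rw [inf_sup_assoc_of_le _ ha₂, sup_comm, h₂, inf_eq_left.2 hc₂]
  have s₂ : c₂ ⊓ (a₀ ⊓ a₁) ≤ c₀ ⊓ c₁ := inf_le_right.trans (inf_le_inf ha₀ ha₁)
  have s₁ : c₁ ⊓ (a₀ ⊓ a₂) ≤ c₀ ⊓ a₂ := inf_le_right.trans (inf_le_inf ha₀ le_rfl)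
  have k₂ : c₀ ⊓ c₁ ⊓ c₂ = c₂ ⊓ (a₀ ⊓ a₁) ⊔ a₂ ⊓ (c₀ ⊓ c₁) := by
    conv_lhs => rw [e₂, inf_comm]
    exact sup_inf_assoc_of_le a₂ s₂
  have k₁ : c₀ ⊓ a₂ ⊓ c₁ = c₁ ⊓ (a₀ ⊓ a₂) ⊔ a₁ ⊓ (c₀ ⊓ a₂) := by
    conv_lhs => rw [e₁, inf_comm]
    exact sup_inf_assoc_of_le a₁ s₁
  rw [k₂, show a₂ ⊓ (c₀ ⊓ c₁) = c₀ ⊓ a₂ ⊓ c₁ by ac_rfl, k₁,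
    show a₁ ⊓ (c₀ ⊓ a₂) = c₀ ⊓ (a₁ ⊓ a₂) by ac_rfl]
  ac_rfl

theorem inf_sup_recover {a₀ c₀ z T : L} (h : a₀ ⊔ z = T) (ha : a₀ ≤ c₀) (hc : c₀ ≤ T) :
    c₀ ⊓ z ⊔ a₀ = c₀ := by
  rw [inf_sup_assoc_of_le _ ha, sup_comm, h, inf_eq_left.2 hc]

/-- Three chains with a common largest element whose least elements are coindependent. -/
structure CoindependentChains (c : Fin 3 → Fin (m + 1) → L) (T : L) : Prop where
  mono : ∀ i, StrictMono (c i)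
  last : ∀ i, c i (Fin.last m) = T
  sup₀ : c 0 0 ⊔ c 1 0 ⊓ c 2 0 = T
  sup₁ : c 1 0 ⊔ c 0 0 ⊓ c 2 0 = T
  sup₂ : c 2 0 ⊔ c 0 0 ⊓ c 1 0 = T

namespace CoindependentChains

variable {c : Fin 3 → Fin (m + 1) → L} {T : L} (h : CoindependentChains c T)
include h

theorem le_top (i : Fin 3) (s : Fin (m + 1)) : c i s ≤ T :=
  (h.last i) ▸ (h.mono i).monotone (Fin.le_last s)

theorem bot_le (i : Fin 3) (s : Fin (m + 1)) : c i 0 ≤ c i s :=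
  (h.mono i).monotone (Fin.zero_le s)

theorem chainMeet_inf (v w : Fin 3 → Fin (m + 1)) :
    chainMeet c (v ⊓ w) = chainMeet c v ⊓ chainMeet c w := by
  simp only [chainMeet, Pi.inf_apply, (h.mono _).monotone.map_inf]
  ac_rfl

theorem chainMeet_eq_sup (v : Fin 3 → Fin (m + 1)) :
    chainMeet c v = c 0 (v 0) ⊓ (c 1 0 ⊓ c 2 0) ⊔ c 1 (v 1) ⊓ (c 0 0 ⊓ c 2 0) ⊔
      c 2 (v 2) ⊓ (c 0 0 ⊓ c 1 0) :=
  inf_eq_sup_of_coindependent h.sup₁ h.sup₂ (h.bot_le _ _) (h.bot_le _ _) (h.bot_le _ _)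
    (h.le_top _ _) (h.le_top _ _)

theorem chain_sup_inf (i : Fin 3) (s t : Fin (m + 1)) (z : L) :
    c i (s ⊔ t) ⊓ z = c i s ⊓ z ⊔ c i t ⊓ z := by
  rcases le_total s t with hst | hst
  · rw [sup_eq_right.2 hst, sup_eq_right.2 (inf_le_inf_right z ((h.mono i).monotone hst))]
  · rw [sup_eq_left.2 hst, sup_eq_left.2 (inf_le_inf_right z ((h.mono i).monotone hst))]

/-- In the sum form each term involves one coordinate only, and in a single chain a join is the
larger of two members. -/
theorem chainMeet_sup (v w : Fin 3 → Fin (m + 1)) :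
    chainMeet c (v ⊔ w) = chainMeet c v ⊔ chainMeet c w := by
  rw [h.chainMeet_eq_sup (v ⊔ w), h.chainMeet_eq_sup v, h.chainMeet_eq_sup w]
  simp only [Pi.sup_apply, h.chain_sup_inf]
  ac_rfl

/-- This recovers the coordinates of a meet from the meet itself, so distinct coordinates give
distinct meets. -/
theorem chainMeet_sup_bot (v : Fin 3 → Fin (m + 1)) (i : Fin 3) :
    chainMeet c v ⊔ c i 0 = c i (v i) := by
  have key : ∀ {a c₀ d e z : L}, a ⊔ z = T → a ≤ c₀ → c₀ ≤ T → z ≤ d ⊓ e →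
      c₀ ⊓ (d ⊓ e) ⊔ a = c₀ := by
    intro a c₀ d e z hz ha hc hzd
    refine le_antisymm (sup_le inf_le_left ha) ?_
    conv_lhs => rw [← inf_sup_recover hz ha hc]
    exact sup_le_sup_right (inf_le_inf_left _ hzd) _
  fin_cases i
  · exact (congrArg (· ⊔ c 0 0) (inf_assoc _ _ _)).trans (key h.sup₀ (h.bot_le _ _) (h.le_top _ _)
      (inf_le_inf (h.bot_le _ _) (h.bot_le _ _)))
  · have := key h.sup₁ (h.bot_le 1 (v 1)) (h.le_top _ _)
      (inf_le_inf (h.bot_le 0 (v 0)) (h.bot_le 2 (v 2)))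
    rwa [← inf_assoc, inf_comm (c 1 _)] at this
  · have := key h.sup₂ (h.bot_le 2 (v 2)) (h.le_top _ _)
      (inf_le_inf (h.bot_le 0 (v 0)) (h.bot_le 1 (v 1)))
    rwa [inf_comm (c 2 _)] at this

theorem chainMeet_le_iff (v w : Fin 3 → Fin (m + 1)) :
    chainMeet c v ≤ chainMeet c w ↔ v ≤ w := by
  constructor
  · intro hvw i
    rw [← (h.mono i).le_iff_le, ← h.chainMeet_sup_bot v i, ← h.chainMeet_sup_bot w i]
    exact sup_le_sup_right hvw _
  · intro hvw
    exact inf_le_inf (inf_le_inf ((h.mono _).monotone (hvw _)) ((h.mono _).monotone (hvw _)))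
      ((h.mono _).monotone (hvw _))

theorem chainMeet_single (i : Fin 3) (s : Fin (m + 1)) :
    chainMeet c (Function.update (fun _ => Fin.last m) i s) = c i s := by
  have hT := h.le_top
  fin_cases i <;> simp [chainMeet, h.last, hT]

/-- A sublattice that contains the three chains and is contained in every sublattice containing
them is isomorphic to their product. -/
theorem exists_orderIso (S : Sublattice L) (hS : ∀ i s, c i s ∈ S)
    (hmin : ∀ S' : Sublattice L, (∀ i s, c i s ∈ S') → S ≤ S') :
    ∃ φ : (Fin 3 → Fin (m + 1)) ≃o S, ∀ v, (φ v : L) = c 0 (v 0) ⊓ c 1 (v 1) ⊓ c 2 (v 2) := by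
  let S' : Sublattice L :=
    { carrier := Set.range (chainMeet c)
      supClosed' := by
        rintro _ ⟨v, rfl⟩ _ ⟨w, rfl⟩; exact ⟨v ⊔ w, h.chainMeet_sup v w⟩
      infClosed' := by
        rintro _ ⟨v, rfl⟩ _ ⟨w, rfl⟩; exact ⟨v ⊓ w, h.chainMeet_inf v w⟩ }
  have hS' : S ≤ S' := hmin S' fun i s => ⟨_, h.chainMeet_single i s⟩
  have hmem : ∀ v, chainMeet c v ∈ S := fun v =>
    S.infClosed (S.infClosed (hS _ _) (hS _ _)) (hS _ _)
  let φ : (Fin 3 → Fin (m + 1)) ↪o S :=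
    OrderEmbedding.ofMapLEIff (fun v => ⟨chainMeet c v, hmem v⟩)
      fun v w => h.chainMeet_le_iff v w
  refine ⟨RelIso.ofSurjective φ ?_, fun v => rfl⟩
  rintro ⟨z, hz⟩
  obtain ⟨v, hv⟩ := hS' hz
  exact ⟨v, Subtype.ext hv⟩

end CoindependentChains

end ChainProduct

namespace D222

/-! ### Indices -/

/-- The indices `i`, `j`, `l` are distinct. -/
def Tri (i j l : Fin 3) : Prop := i ≠ j ∧ j ≠ l ∧ i ≠ l

theorem Tri.third {i j l : Fin 3} (h : Tri i j l) : third i j = l := by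
  revert i j l; unfold Tri D222.third; decide

theorem Tri.rot {i j l : Fin 3} (h : Tri i j l) : Tri j l i := ⟨h.2.1, h.2.2.symm, h.1.symm⟩

theorem Tri.swap {i j l : Fin 3} (h : Tri i j l) : Tri j i l := ⟨h.1.symm, h.2.2, h.2.1⟩

theorem tri_perm (σ : Equiv.Perm (Fin 3)) : Tri (σ 0) (σ 1) (σ 2) :=
  ⟨σ.injective.ne (by decide), σ.injective.ne (by decide), σ.injective.ne (by decide)⟩

/-! ### Atomic elements -/

theorem a_zero (i j : Fin 3) : a 0 i j = ⊤ := rfl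

theorem A_zero (i j : Fin 3) : A 0 i j = ⊤ := rfl

theorem a_succ {i j l : Fin 3} (h : Tri i j l) (n : ℕ) : a (n + 1) i j = x i ⊔ y j ⊓ a n j l := by
  rw [a, h.third]

theorem A_succ {i j l : Fin 3} (h : Tri i j l) (n : ℕ) : A (n + 1) i j = y i ⊔ x j ⊓ A n l i := by
  rw [A, h.third]

theorem a_antitone_succ (n : ℕ) (i j : Fin 3) : a (n + 1) i j ≤ a n i j := by
  induction n generalizing i j with
  | zero => exact le_top
  | succ n ih => exact sup_le_sup_left (inf_le_inf_left _ (ih _ _)) _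

theorem A_antitone_succ (n : ℕ) (i j : Fin 3) : A (n + 1) i j ≤ A n i j := by
  induction n generalizing i j with
  | zero => exact le_top
  | succ n ih => exact sup_le_sup_left (inf_le_inf_left _ (ih _ _)) _

theorem x_le_a (n : ℕ) (i j : Fin 3) : x i ≤ a n i j := by
  cases n with
  | zero => exact le_top
  | succ n => exact le_sup_left

theorem y_le_A (n : ℕ) (i j : Fin 3) : y i ≤ A n i j := by
  cases n with
  | zero => exact le_top
  | succ n => exact le_sup_left

theorem x_le_A (n : ℕ) (i j : Fin 3) : x i ≤ A n i j := (x_le_y i).trans (y_le_A n i j)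

theorem x_snd_le_a (n : ℕ) (i j : Fin 3) : x j ≤ a n i j := by
  cases n with
  | zero => exact le_top
  | succ n => exact le_sup_of_le_right (le_inf (x_le_y j) (x_le_a _ _ _))

theorem y_inf_y_inf_a_le {i j l : Fin 3} (h : Tri i j l) (q : ℕ) :
    y i ⊓ y j ⊓ a q i l ≤ a q j i := by
  cases q with
  | zero => exact le_top
  | succ q =>
    rw [a_succ h.swap]
    exact le_sup_of_le_right (le_inf (inf_le_left.trans inf_le_left)
      (inf_le_right.trans (a_antitone_succ q i l)))

theorem x_inf_A_le {i j l : Fin 3} (h : Tri i j l) (q : ℕ) : x l ⊓ A q i j ≤ A q j l := by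
  cases q with
  | zero => exact le_top
  | succ q =>
    rw [A_succ h.rot]
    exact le_sup_of_le_right (inf_le_inf_left _ (A_antitone_succ q i j))

/-- Two uses of the modular law: x_j lies below A_q^{jl}, so the meet with it only shrinks x_i; that
smaller term and y_l both lie below A_q^{li}, so meeting with A_q^{li} only shrinks x_j. -/
theorem y_inf_sup_inf_A_le {i j l : Fin 3} (h : Tri i j l) (q : ℕ) :
    y l ⊓ (x i ⊔ x j) ⊓ A q j l ≤ A (q + 1) i j := by
  have h₂ : x i ⊓ A q j l ≤ A q l i := by
    cases q with
    | zero => exact le_top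
    | succ q =>
      rw [A_succ h.rot.rot]
      exact le_sup_of_le_right (inf_le_inf_left _ (A_antitone_succ q j l))
  have h₃ : (x i ⊔ x j) ⊓ A q j l = x i ⊓ A q j l ⊔ x j := by
    rw [sup_comm, sup_inf_assoc_of_le _ (x_le_A q j l), sup_comm]
  have h₄ : y l ⊓ (x i ⊓ A q j l ⊔ x j) ≤ x i ⊓ A q j l ⊔ x j ⊓ A q l i := by
    calc y l ⊓ (x i ⊓ A q j l ⊔ x j)
        ≤ (x i ⊓ A q j l ⊔ x j) ⊓ A q l i :=
          le_inf inf_le_right (inf_le_left.trans (y_le_A q l i))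
      _ = x i ⊓ A q j l ⊔ x j ⊓ A q l i := sup_inf_assoc_of_le _ h₂
  rw [inf_assoc, h₃, A_succ h]
  exact h₄.trans (sup_le_sup_right (inf_le_left.trans (x_le_y i)) _)

/-! ### The shapes of the admissible elements -/

/-- The elements `e_α` of the odd types. -/
def P (i j l : Fin 3) (α β γ δ : ℕ) : D222 := y j ⊓ A α l j ⊓ a β j i ⊓ A γ i l ⊓ a δ i l

/-- The elements `e_α` of the even types. -/
def Q (i j l : Fin 3) (α β γ δ : ℕ) : D222 := y l ⊓ a α l i ⊓ A β i j ⊓ a γ i j ⊓ A δ j l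

/-- The elements `f_α` that lie below two of the `y`. -/
def G (i j l : Fin 3) (q k : ℕ) : D222 := y i ⊓ y j ⊓ a q i l ⊓ A k l j

/-- The elements `f_α` with a factor `x_i + x_j`. -/
def M (i j l : Fin 3) (q k : ℕ) : D222 := y l ⊓ (x i ⊔ x j) ⊓ A q j l ⊓ a k l i

/-- The elements `f_α` that lie below one of the `x`. -/
def N (i j l : Fin 3) (q k : ℕ) : D222 := x l ⊓ A q i j ⊓ a k i j

theorem G_le_P {i j l : Fin 3} (h : Tri i j l) (q k : ℕ) : G i j l q k ≤ P i j l k q (k + 1) q := by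
  unfold G P
  have h₁ := y_inf_y_inf_a_le h q
  have h₂ := y_le_A (k + 1) i l
  refine le_inf (le_inf (le_inf (le_inf ?_ ?_) ?_) ?_) ?_
  · exact inf_le_left.trans (inf_le_left.trans inf_le_right)
  · exact inf_le_right
  · exact inf_le_left.trans h₁
  · exact inf_le_left.trans (inf_le_left.trans (inf_le_left.trans h₂))
  · exact inf_le_left.trans inf_le_right

theorem G_le_P_rot {i j l : Fin 3} (h : Tri i j l) (q k : ℕ) :
    G j l i q k ≤ P i j l k q k (q + 1) := by
  unfold G P
  have h₁ := y_inf_y_inf_a_le h.rot q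
  refine le_inf (le_inf (le_inf (le_inf ?_ ?_) ?_) ?_) ?_
  · exact inf_le_left.trans (inf_le_left.trans inf_le_left)
  · exact inf_le_left.trans (inf_le_left.trans (inf_le_right.trans (y_le_A k l j)))
  · exact inf_le_left.trans inf_le_right
  · exact inf_le_right
  · rw [a_succ ⟨h.2.2, h.2.1.symm, h.1⟩]
    refine inf_le_left.trans (le_sup_of_le_right (le_inf ?_ h₁))
    exact inf_le_left.trans inf_le_right

theorem M_le_Q {i j l : Fin 3} (h : Tri i j l) (q k : ℕ) :
    M i j l q k ≤ Q i j l k (q + 1) (k + 1) q := by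
  unfold M Q
  refine le_inf (le_inf (le_inf (le_inf ?_ ?_) ?_) ?_) ?_
  · exact inf_le_left.trans (inf_le_left.trans inf_le_left)
  · exact inf_le_right
  · exact inf_le_left.trans (y_inf_sup_inf_A_le h q)
  · exact inf_le_left.trans (inf_le_left.trans (inf_le_right.trans
      (sup_le (x_le_a _ _ _) (x_snd_le_a _ _ _))))
  · exact inf_le_left.trans inf_le_right

theorem N_le_Q {i j l : Fin 3} (h : Tri i j l) (q k : ℕ) : N i j l q k ≤ Q i j l k q k q := by
  unfold N Q
  refine le_inf (le_inf (le_inf (le_inf ?_ ?_) ?_) ?_) ?_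
  · exact inf_le_left.trans (inf_le_left.trans (x_le_y l))
  · exact inf_le_left.trans (inf_le_left.trans (x_le_a k l i))
  · exact inf_le_left.trans inf_le_right
  · exact inf_le_right
  · exact inf_le_left.trans (x_inf_A_le h q)

theorem f_eq (i j l : Fin 3) (k p : ℕ) : f i j l k p =
    ![G i j l (k + 3 * p) (k - 1), M i j l (k + 3 * p) (k - 1), G l i j (k + 3 * p + 1) (k - 1),
      M l i j (k + 3 * p + 1) (k - 1), G j l i (k + 3 * p + 2) (k - 1),
      M j l i (k + 3 * p + 2) (k - 1), N j l i k k, M j l i k k, G j l i (k + 3 * p) k,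
      N i j l (k + 3 * p + 1) k, G i j l (k + 3 * p + 1) k, N l i j (k + 3 * p + 2) k,
      G l i j (k + 3 * p + 2) k, N j l i (k + 3 * p + 3) k] := rfl

theorem e_eq (i j l : Fin 3) (k p : ℕ) : e i j l k p =
    ![P i j l (k - 1) (k + 3 * p) k (k + 3 * p),
      Q i j l (k - 1) (k + 3 * p + 1) k (k + 3 * p),
      P l i j (k - 1) (k + 3 * p + 1) k (k + 3 * p + 1),
      Q l i j (k - 1) (k + 3 * p + 2) k (k + 3 * p + 1),
      P j l i (k - 1) (k + 3 * p + 2) k (k + 3 * p + 2),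
      Q j l i (k - 1) (k + 3 * p + 3) k (k + 3 * p + 2),
      Q j l i k k k k, Q j l i k (k + 1) (k + 1) k,
      P i j l k (k + 3 * p) k (k + 3 * p + 1),
      Q i j l k (k + 3 * p + 1) k (k + 3 * p + 1),
      P l i j k (k + 3 * p + 1) k (k + 3 * p + 2),
      Q l i j k (k + 3 * p + 2) k (k + 3 * p + 2),
      P j l i k (k + 3 * p + 2) k (k + 3 * p + 3),
      Q j l i k (k + 3 * p + 3) k (k + 3 * p + 3)] := by
  unfold e
  have h₁ : y i ⊓ A k l i ⊓ a k i j ⊓ A k j l ⊓ a k j l = Q j l i k k k k := by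
    unfold Q; ac_rfl
  have h₂ : y i ⊓ A k l i ⊓ a k i j ⊓ A (k + 1) j l ⊓ a (k + 1) j l =
      Q j l i k (k + 1) (k + 1) k := by
    unfold Q; ac_rfl
  simp only [h₁, h₂]
  rfl

theorem f_le_e {i j l : Fin 3} (h : Tri i j l) (k p : ℕ) (r : Fin 14) (hk : r < 6 → 0 < k) :
    f i j l k p r ≤ e i j l k p r := by
  rw [f_eq, e_eq]
  by_cases hr : r < 6
  -- Positivity of k makes the truncated `k - 1` in these six types a true predecessor.
  · obtain ⟨k, rfl⟩ := Nat.exists_eq_succ_of_ne_zero (hk hr).ne'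
    simp only [Nat.succ_eq_add_one, Nat.add_sub_cancel]
    fin_cases r <;> first | exact absurd hr (by decide) | skip
    exacts [G_le_P h _ _, M_le_Q h _ _, G_le_P h.rot.rot _ _, M_le_Q h.rot.rot _ _,
      G_le_P h.rot _ _, M_le_Q h.rot _ _]
  · fin_cases r <;> first | exact absurd (by decide) hr | skip
    exacts [N_le_Q h.rot _ _, M_le_Q h.rot _ _, G_le_P_rot h _ _, N_le_Q h _ _,
      G_le_P_rot h.rot.rot _ _, N_le_Q h.rot.rot _ _, G_le_P_rot h.rot _ _, N_le_Q h.rot _ _]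

/-! ### Cumulative elements -/

/-- The length of the admissible sequences. -/
def len (k p : ℕ) : Fin 14 → ℕ :=
  ![6 * p + 4 * k, 6 * p + 4 * k + 1, 6 * p + 4 * k + 2, 6 * p + 4 * k + 3, 6 * p + 4 * k + 4,
    6 * p + 4 * k + 5, 4 * k + 1, 4 * k + 3, 6 * p + 4 * k + 2, 6 * p + 4 * k + 3,
    6 * p + 4 * k + 4, 6 * p + 4 * k + 5, 6 * p + 4 * k + 6, 6 * p + 4 * k + 7]

theorem length_adm (i j l : Fin 3) (k p : ℕ) (r : Fin 14) :
    (adm i j l k p r).length = len k p r := by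
  fin_cases r <;> simp [adm, len, gam, bet, rep] <;> ring

theorem mem_params {t : Fin 3} {n : ℕ} {σ : Equiv.Perm (Fin 3)} {r : Fin 14} {k p : ℕ} :
    (σ, r, k, p) ∈ params t n ↔ (k ≤ n ∧ p ≤ n) ∧ σ 0 = t ∧ (r < 6 → 0 < k) ∧ len k p r = n := by
  simp only [params, Finset.mem_filter, Finset.mem_product, Finset.mem_univ, Finset.mem_range,
    true_and, length_adm, Nat.lt_succ_iff]

theorem cumX_le_cumY (t : Fin 3) (n : ℕ) : cumX t n ≤ cumY t n := by
  refine Finset.sup_mono_fun ?_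
  rintro ⟨σ, r, k, p⟩ hs
  exact f_le_e (tri_perm σ) k p r (mem_params.1 hs).2.2.1

theorem params_zero (t : Fin 3) : params t 0 = ∅ := by
  refine Finset.eq_empty_of_forall_notMem ?_
  rintro ⟨σ, r, k, p⟩ hs
  obtain ⟨⟨hk, hp⟩, -, h₁, h₂⟩ := mem_params.1 hs
  obtain rfl : k = 0 := by omega
  have hr : ¬ r < 6 := fun hr => absurd (h₁ hr) (by omega)
  fin_cases r <;> first | exact hr (by decide) | (simp [len] at h₂)

theorem cumX_zero (t : Fin 3) : cumX t 0 = ⊥ := by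
  rw [cumX, params_zero, Finset.sup_empty]

/-- The parameter p stays free because sequences of type 6 do not involve it. -/
theorem eq_of_mem_params_one {t : Fin 3} {σ : Equiv.Perm (Fin 3)} {r : Fin 14} {k p : ℕ}
    (hs : (σ, r, k, p) ∈ params t 1) : σ 0 = t ∧ r = 6 ∧ k = 0 := by
  obtain ⟨-, h₀, h₁, h₂⟩ := mem_params.1 hs
  refine ⟨h₀, ?_⟩
  by_cases hr : r < 6
  · have := h₁ hr
    fin_cases r <;> first | exact absurd hr (by decide) | (simp [len] at h₂; try omega)
  · fin_cases r <;> first | exact absurd (by decide) hr | (simp [len] at h₂; try omega)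
    exact ⟨rfl, h₂⟩

theorem eq_of_mem_params_two {t : Fin 3} {σ : Equiv.Perm (Fin 3)} {r : Fin 14} {k p : ℕ}
    (hs : (σ, r, k, p) ∈ params t 2) : r = 8 ∧ k = 0 ∧ p = 0 := by
  obtain ⟨-, h₀, h₁, h₂⟩ := mem_params.1 hs
  by_cases hr : r < 6
  · have := h₁ hr
    fin_cases r <;> first | exact absurd hr (by decide) | (simp [len] at h₂; try omega)
  · fin_cases r <;> first | exact absurd (by decide) hr | (simp [len] at h₂; try omega)
    exact ⟨rfl, h₂.2, h₂.1⟩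

theorem params_one_nonempty (t : Fin 3) : (Equiv.swap 0 t, 6, 0, 0) ∈ params t 1 := by
  rw [mem_params]
  refine ⟨by omega, by simp, by decide, rfl⟩

theorem cumX_one (t : Fin 3) : cumX t 1 = x t := by
  refine le_antisymm (Finset.sup_le ?_) ?_
  · rintro ⟨σ, r, k, p⟩ hs
    obtain ⟨rfl, rfl, rfl⟩ := eq_of_mem_params_one hs
    exact inf_le_left.trans inf_le_left
  · refine le_trans ?_ (Finset.le_sup (params_one_nonempty t))
    simp [f, a_zero, A_zero]

theorem cumY_one (t : Fin 3) : cumY t 1 = y t := by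
  refine le_antisymm (Finset.sup_le ?_) ?_
  · rintro ⟨σ, r, k, p⟩ hs
    obtain ⟨rfl, rfl, rfl⟩ := eq_of_mem_params_one hs
    exact inf_le_left.trans (inf_le_left.trans (inf_le_left.trans inf_le_left))
  · refine le_trans ?_ (Finset.le_sup (params_one_nonempty t))
    simp [e, a_zero, A_zero]

/-- There are no admissible sequences of length zero and y_t(1) = y_t, so the separate definition at
n = 0 is an instance of the general one. -/
theorem genA_eq (n : ℕ) (i : Fin 3) : genA n i =
    cumX (i + 1) n ⊔ cumX (i + 2) n ⊔ cumY (i + 1) (n + 1) ⊔ cumY (i + 2) (n + 1) := by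
  cases n with
  | zero => simp [genA, cumX_zero, cumY_one]
  | succ n => rfl

theorem genB_eq (n : ℕ) (i : Fin 3) : genB n i = genA n i ⊔ cumX i (n + 1) := by
  cases n with
  | zero => simp only [genA, genB, zero_add, cumX_one]; ac_rfl
  | succ n => rfl

theorem genC_eq (n : ℕ) (i : Fin 3) : genC n i = genA n i ⊔ cumY i (n + 1) := by
  cases n with
  | zero =>
    simp only [genA, genC, zero_add, cumY_one]
    fin_cases i
    · change y 0 ⊔ y 1 ⊔ y 2 = y 1 ⊔ y 2 ⊔ y 0; ac_rfl
    · change y 0 ⊔ y 1 ⊔ y 2 = y 2 ⊔ y 0 ⊔ y 1; ac_rfl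
    · rfl
  | succ n => rfl

/-! ### Representations and the reflection functor -/

/-- A representation of `D^{2,2,2}` in the lattice of subspaces of a rational vector space. -/
structure Model where
  /-- The ambient space. -/
  V : Type
  [grp : AddCommGroup V]
  [mod : Module ℚ V]
  /-- The smaller subspaces. -/
  x : Fin 3 → Submodule ℚ V
  /-- The larger subspaces. -/
  y : Fin 3 → Submodule ℚ V
  le : ∀ i, x i ≤ y i

namespace Model

attribute [instance] Model.grp Model.mod

variable (R : Model)

/-- The value of a polynomial. -/
def polyEval : Poly → Submodule ℚ R.V
  | .x i => R.x i
  | .y i => R.y i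
  | .one => ⊤
  | .sum s t => polyEval s ⊔ polyEval t
  | .inter s t => polyEval s ⊓ polyEval t

theorem polyEval_mono {s t : Poly} (h : Poly.Le s t) : R.polyEval s ≤ R.polyEval t := by
  induction h with
  | refl s => exact le_rfl
  | trans _ _ h₁ h₂ => exact h₁.trans h₂
  | left_sum s t => exact le_sup_left
  | right_sum s t => exact le_sup_right
  | sum_le _ _ h₁ h₂ => exact sup_le h₁ h₂
  | inter_left s t => exact inf_le_left
  | inter_right s t => exact inf_le_right
  | le_inter _ _ h₁ h₂ => exact le_inf h₁ h₂
  | le_one s => exact le_top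
  | modular t _ h => exact sup_inf_le_assoc_of_le _ h
  | x_le_y i => exact R.le i

/-- The value of an element of `D^{2,2,2}` in a representation. -/
def ev : D222 → Submodule ℚ R.V :=
  Quotient.lift R.polyEval fun _ _ h => le_antisymm (R.polyEval_mono h.1) (R.polyEval_mono h.2)

@[simp] theorem ev_x (i : Fin 3) : R.ev (D222.x i) = R.x i := rfl

@[simp] theorem ev_y (i : Fin 3) : R.ev (D222.y i) = R.y i := rfl

@[simp] theorem ev_top : R.ev ⊤ = ⊤ := rfl

@[simp] theorem ev_sup (s t : D222) : R.ev (s ⊔ t) = R.ev s ⊔ R.ev t := by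
  induction s using Quotient.inductionOn
  induction t using Quotient.inductionOn
  rfl

@[simp] theorem ev_inf (s t : D222) : R.ev (s ⊓ t) = R.ev s ⊓ R.ev t := by
  induction s using Quotient.inductionOn
  induction t using Quotient.inductionOn
  rfl

theorem ev_mono {s t : D222} (h : s ≤ t) : R.ev s ≤ R.ev t := by
  rw [← sup_eq_right.2 h, ev_sup]; exact le_sup_left

/-- Every subrepresentation has negative defect. -/
structure Negative : Prop where
  finite : Module.Finite ℚ R.V
  nontrivial : Nontrivial R.V
  defect : ∀ U : Submodule ℚ R.V, U ≠ ⊥ →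
    ∑ i, (Module.finrank ℚ ↥(R.x i ⊓ U) + Module.finrank ℚ ↥(R.y i ⊓ U)) < 3 * Module.finrank ℚ U

variable {R}

/-- A nonzero intersection U would lie in x_i, y_i, x_j and y_j, contributing 4 dim U to a sum that
must be below 3 dim U. -/
theorem Negative.x_inf_x (h : R.Negative) {i j : Fin 3} (hij : i ≠ j) : R.x i ⊓ R.x j = ⊥ := by
  by_contra hne
  have hd := h.defect _ hne
  have hx : ∀ t, (t = i ∨ t = j) → R.x t ⊓ (R.x i ⊓ R.x j) = R.x i ⊓ R.x j := by
    rintro t (rfl | rfl)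
    · exact inf_eq_right.2 inf_le_left
    · exact inf_eq_right.2 inf_le_right
  have hy : ∀ t, (t = i ∨ t = j) → R.y t ⊓ (R.x i ⊓ R.x j) = R.x i ⊓ R.x j := by
    rintro t (rfl | rfl)
    · exact inf_eq_right.2 (inf_le_left.trans (R.le _))
    · exact inf_eq_right.2 (inf_le_right.trans (R.le _))
  have hsub : ∑ t ∈ {i, j}, (Module.finrank ℚ ↥(R.x t ⊓ (R.x i ⊓ R.x j)) +
      Module.finrank ℚ ↥(R.y t ⊓ (R.x i ⊓ R.x j))) ≤ _ :=
    Finset.sum_le_sum_of_subset (Finset.subset_univ _)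
  rw [Finset.sum_pair hij, hx i (.inl rfl), hx j (.inr rfl), hy i (.inl rfl), hy j (.inr rfl)]
    at hsub
  omega

theorem Negative.ev_bot (h : R.Negative) : R.ev ⊥ = ⊥ := by
  change R.ev (D222.x 0 ⊓ D222.x 1 ⊓ D222.x 2) = ⊥
  simp [h.x_inf_x (show (0 : Fin 3) ≠ 1 by decide)]

end Model

/-- The maps from a representation to its reflection. -/
structure Step (R R' : Model) where
  /-- The elementary maps. -/
  φ : Fin 3 → R.V →ₗ[ℚ] R'.V
  sum_eq_zero : ∀ w, ∑ i, φ i w = 0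
  eq_zero_iff : ∀ i w, φ i w = 0 ↔ w ∈ R.x i
  range_eq : ∀ i, LinearMap.range (φ i) = R'.y i
  map_y : ∀ i, (R.y i).map (φ i) = R'.x i
  exists_lift : ∀ w : Fin 3 → R.V, ∑ i, φ i (w i) = 0 → ∃ u, ∀ i, φ i u = φ i (w i)
  iSup_y : ⨆ i, R'.y i = ⊤

/-- The codimension in U of the preimage of B is at most the codimension of B in C, since f induces
an injection of the quotients. -/
theorem finrank_add_le_of_map_le {V W : Type*} [AddCommGroup V] [Module ℚ V] [AddCommGroup W]
    [Module ℚ W] [Module.Finite ℚ V] [Module.Finite ℚ W] (f : W →ₗ[ℚ] V) {U : Submodule ℚ W}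
    {B C : Submodule ℚ V} (hU : U.map f ≤ C) (hB : B ≤ C) :
    Module.finrank ℚ U + Module.finrank ℚ B ≤
      Module.finrank ℚ ↥(B.comap f ⊓ U) + Module.finrank ℚ C := by
  have hrank : ∀ S : Submodule ℚ W, Module.finrank ℚ S =
      Module.finrank ℚ ↥(S.map f) + Module.finrank ℚ ↥(LinearMap.ker f ⊓ S) := by
    intro S
    have h := LinearMap.finrank_range_add_finrank_ker (f.domRestrict S)
    rw [LinearMap.range_domRestrict, LinearMap.ker_domRestrict] at h
    rw [← h,
      ← (Submodule.comapSubtypeEquivOfLe (inf_le_right : LinearMap.ker f ⊓ S ≤ S)).finrank_eq,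
      Submodule.comap_inf, Submodule.comap_subtype_self, inf_top_eq]
  have h₁ := hrank U
  have h₂ := hrank (B.comap f ⊓ U)
  have h₃ : (B.comap f ⊓ U).map f = B ⊓ U.map f := by
    ext v
    constructor
    · rintro ⟨w, hw, rfl⟩; exact ⟨hw.1, w, hw.2, rfl⟩
    · rintro ⟨hv, w, hw, rfl⟩; exact ⟨w, ⟨hv, hw⟩, rfl⟩
  have h₄ : LinearMap.ker f ⊓ (B.comap f ⊓ U) = LinearMap.ker f ⊓ U := by
    rw [← inf_assoc, inf_eq_left.2 (LinearMap.ker_le_comap f)]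
  have h₅ := Submodule.finrank_sup_add_finrank_inf_eq B (U.map f)
  have h₆ := Submodule.finrank_mono (sup_le hB hU)
  rw [h₃, h₄] at h₂
  omega

namespace Step

variable {R R' : Model} (S : Step R R')
include S

theorem φ_mem (i : Fin 3) (w : R.V) : S.φ i w ∈ R'.y i := by
  rw [← S.range_eq]; exact ⟨w, rfl⟩

theorem mem_y {i : Fin 3} {w : R.V} : w ∈ R.y i ↔ S.φ i w ∈ R'.x i := by
  rw [← S.map_y]
  refine ⟨fun h => ⟨w, h, rfl⟩, ?_⟩
  rintro ⟨u, hu, huw⟩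
  have : u - w ∈ R.x i := by rw [← S.eq_zero_iff, map_sub, huw, sub_self]
  simpa using sub_mem hu (R.le i this)

/-- A subspace U of the reflection is compared with T, the vectors that all three elementary maps
send into U. The estimates `hx`, `hy` and `hsum` turn the defect inequality for T into the one for
U. -/
theorem negative (hR : R.Negative) (hV : Module.Finite ℚ R'.V) : R'.Negative := by
  have := hR.finite
  refine ⟨hV, ?_, ?_⟩
  · by_contra hn
    rw [not_nontrivial_iff_subsingleton] at hn
    have hx : ∀ i, R.x i = ⊤ := fun i => by
      rw [eq_top_iff]; intro w _; rw [← S.eq_zero_iff]; exact Subsingleton.elim _ _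
    have h₀ := hR.x_inf_x (show (0 : Fin 3) ≠ 1 by decide)
    have := hR.nontrivial
    rw [hx, hx, top_inf_eq] at h₀
    exact top_ne_bot h₀
  · intro U hU
    let T : Submodule ℚ R.V := ⨅ i, U.comap (S.φ i)
    have hT : ∀ i, T.map (S.φ i) ≤ R'.y i ⊓ U := by
      intro i
      rintro _ ⟨w, hw, rfl⟩
      exact ⟨S.φ_mem i w, (Submodule.mem_iInf _).1 hw i⟩
    have hx : ∀ i, Module.finrank ℚ T ≤
        Module.finrank ℚ ↥(R.x i ⊓ T) + Module.finrank ℚ ↥(R'.y i ⊓ U) := by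
      intro i
      have h := finrank_add_le_of_map_le (S.φ i) (hT i) (bot_le : ⊥ ≤ _)
      have hc : (⊥ : Submodule ℚ R'.V).comap (S.φ i) = R.x i := by
        ext w; simp [S.eq_zero_iff]
      rwa [hc, finrank_bot, add_zero] at h
    have hy : ∀ i, Module.finrank ℚ T + Module.finrank ℚ ↥(R'.x i ⊓ U) ≤
        Module.finrank ℚ ↥(R.y i ⊓ T) + Module.finrank ℚ ↥(R'.y i ⊓ U) := by
      intro i
      have h := finrank_add_le_of_map_le (S.φ i) (hT i)
        (inf_le_inf_right U (R'.le i) : R'.x i ⊓ U ≤ _)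
      have hc : (R'.x i ⊓ U).comap (S.φ i) ⊓ T = R.y i ⊓ T := by
        ext w
        simp only [Submodule.mem_inf, Submodule.mem_comap, ← S.mem_y]
        refine ⟨fun h => ⟨h.1.1, h.2⟩, fun h => ⟨⟨h.1, (Submodule.mem_iInf _).1 h.2 i⟩, h.2⟩⟩
      rwa [hc] at h
    -- Rank and nullity of the addition map into U: a zero-sum triple of elements of the y_i inside
    -- U comes from one vector, which then lies in T.
    have hsum : ∑ i, Module.finrank ℚ ↥(R'.y i ⊓ U) ≤ Module.finrank ℚ T + Module.finrank ℚ U := by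
      let g : (∀ i : Fin 3, ↥(R'.y i ⊓ U)) →ₗ[ℚ] R'.V :=
        ∑ i, (R'.y i ⊓ U).subtype ∘ₗ LinearMap.proj i
      have hg : ∀ v, g v = ∑ i, (v i : R'.V) := fun v => by simp [g]
      have hrange : LinearMap.range g ≤ U := by
        rintro _ ⟨v, rfl⟩
        rw [hg]
        exact sum_mem fun i _ => (v i).2.2
      let d : T →ₗ[ℚ] (∀ i : Fin 3, ↥(R'.y i ⊓ U)) :=
        LinearMap.pi fun i => ((S.φ i).domRestrict T).codRestrict _
          fun w => hT i ⟨w, w.2, rfl⟩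
      have hker : LinearMap.ker g ≤ LinearMap.range d := by
        intro v hv
        rw [LinearMap.mem_ker, hg] at hv
        have hlift : ∀ i, ∃ w, S.φ i w = v i := fun i => by
          have hv : (v i : R'.V) ∈ LinearMap.range (S.φ i) := (S.range_eq i).symm ▸ (v i).2.1
          exact hv
        choose w hw using hlift
        obtain ⟨u, hu⟩ := S.exists_lift w (by simpa only [hw] using hv)
        have huT : u ∈ T := by
          rw [Submodule.mem_iInf]
          intro i
          rw [Submodule.mem_comap, hu, hw]
          exact (v i).2.2
        refine ⟨⟨u, huT⟩, ?_⟩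
        ext i
        exact (hu i).trans (hw i)
      have h₁ := LinearMap.finrank_range_add_finrank_ker g
      rw [Module.finrank_pi_fintype] at h₁
      have h₂ := Submodule.finrank_mono hrange
      have h₃ := Submodule.finrank_mono hker
      have h₄ := LinearMap.finrank_range_le d
      omega
    have hle : ∀ i, Module.finrank ℚ ↥(R'.x i ⊓ U) ≤ Module.finrank ℚ ↥(R'.y i ⊓ U) := fun i =>
      Submodule.finrank_mono (inf_le_inf_right U (R'.le i))
    have hpos : 0 < Module.finrank ℚ U :=
      Nat.pos_of_ne_zero fun h0 => hU (Submodule.finrank_eq_zero.1 h0)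
    have hx₀ := hx 0
    have hx₁ := hx 1
    have hx₂ := hx 2
    have hy₀ := hy 0
    have hy₁ := hy 1
    have hy₂ := hy 2
    have hl₀ := hle 0
    have hl₁ := hle 1
    have hl₂ := hle 2
    simp only [Fin.sum_univ_three] at hsum ⊢
    by_cases hT0 : T = ⊥
    -- The defect of T says nothing here, but `hsum` and x_i ⊆ y_i already bound the total by 2 dim
    -- U.
    · have : Module.finrank ℚ T = 0 := by rw [hT0]; exact finrank_bot ℚ R.V
      omega
    · have hd := hR.defect T hT0
      simp only [Fin.sum_univ_three] at hd
      omega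

end Step

/-! ### Construction of the reflected representation -/

namespace Model

variable (R : Model)

/-- The relations of the reflected representation. -/
def relations : Submodule ℚ (Fin 3 → R.V) :=
  Submodule.pi Set.univ R.x ⊔ LinearMap.range (LinearMap.pi fun _ : Fin 3 => LinearMap.id (R := ℚ))

/-- The elementary maps to the reflected representation. -/
def reflectMap (i : Fin 3) : R.V →ₗ[ℚ] (Fin 3 → R.V) ⧸ R.relations :=
  R.relations.mkQ ∘ₗ LinearMap.single ℚ (fun _ => R.V) i

/-- The reflected representation. -/
def reflect : Model where
  V := (Fin 3 → R.V) ⧸ R.relations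
  x i := (R.y i).map (R.reflectMap i)
  y i := LinearMap.range (R.reflectMap i)
  le _ := LinearMap.map_le_range

variable {R}

theorem mem_relations {w : Fin 3 → R.V} :
    w ∈ R.relations ↔ ∃ u, ∀ i, w i - u ∈ R.x i := by
  rw [relations, Submodule.mem_sup]
  constructor
  · rintro ⟨d, hd, _, ⟨u, rfl⟩, rfl⟩
    exact ⟨u, fun i => by simpa using hd i trivial⟩
  · rintro ⟨u, hu⟩
    exact ⟨fun i => w i - u, fun i _ => hu i, _, ⟨u, rfl⟩, by ext i; simp⟩

theorem sum_reflectMap (w : Fin 3 → R.V) :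
    ∑ i, R.reflectMap i (w i) = R.relations.mkQ w := by
  simp only [reflectMap, LinearMap.comp_apply, ← map_sum]
  congr 1
  exact LinearMap.sum_single_apply _ w

theorem Negative.eq_zero_of_forall_ne_mem (h : R.Negative) (i : Fin 3) {u : R.V}
    (hu : ∀ j, j ≠ i → u ∈ R.x j) : u = 0 := by
  have hij : ∃ j l : Fin 3, j ≠ i ∧ l ≠ i ∧ j ≠ l := by
    clear hu; revert i; decide
  obtain ⟨j, l, hj, hl, hjl⟩ := hij
  have : u ∈ R.x j ⊓ R.x l := ⟨hu j hj, hu l hl⟩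
  rwa [h.x_inf_x hjl, Submodule.mem_bot] at this

theorem reflectMap_eq_of_forall_sub {w : Fin 3 → R.V} {u : R.V} (hu : ∀ i, w i - u ∈ R.x i)
    (i : Fin 3) : R.reflectMap i u = R.reflectMap i (w i) := by
  rw [eq_comm, ← sub_eq_zero, ← map_sub]
  refine (Submodule.Quotient.mk_eq_zero _).2 (mem_relations.2 ⟨0, fun j => ?_⟩)
  rcases eq_or_ne j i with rfl | hj
  · simpa using hu j
  · simp [Pi.single_eq_of_ne hj]

/-- A negative representation has elementary maps to its reflection. -/
def Negative.step (h : R.Negative) : Step R R.reflect where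
  φ := R.reflectMap
  sum_eq_zero w := by
    refine (sum_reflectMap fun _ => w).trans ?_
    refine (Submodule.Quotient.mk_eq_zero _).2 (mem_relations.2 ⟨w, fun i => ?_⟩)
    simp
  eq_zero_iff i w := by
    refine (Submodule.Quotient.mk_eq_zero _).trans (mem_relations.trans ?_)
    constructor
    · rintro ⟨u, hu⟩
      -- The diagonal part u of the relation lies in the two subspaces x_j with j ≠ i, which meet in
      -- zero.
      have h0 : u = 0 := h.eq_zero_of_forall_ne_mem i fun j hj => by
        simpa [LinearMap.single_apply, Pi.single_eq_of_ne hj] using hu j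
      simpa [h0] using hu i
    · intro hw
      refine ⟨0, fun j => ?_⟩
      rcases eq_or_ne j i with rfl | hj
      · simpa using hw
      · simp [Pi.single_eq_of_ne hj]
  range_eq i := rfl
  map_y i := rfl
  exists_lift w hw := by
    have hw' := (sum_reflectMap w).symm.trans hw
    obtain ⟨u, hu⟩ := mem_relations.1 ((Submodule.Quotient.mk_eq_zero _).1 hw')
    exact ⟨u, reflectMap_eq_of_forall_sub hu⟩
  iSup_y := by
    rw [eq_top_iff]
    rintro v -
    obtain ⟨w, rfl⟩ := R.relations.mkQ_surjective v
    rw [← sum_reflectMap]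
    exact sum_mem fun i _ => Submodule.mem_iSup_of_mem i ⟨w i, rfl⟩

theorem Negative.reflect (h : R.Negative) : R.reflect.Negative := by
  have := h.finite
  exact h.step.negative h (inferInstanceAs (Module.Finite ℚ ((Fin 3 → R.V) ⧸ R.relations)))

variable (R) in
/-- The iterated reflections of a representation. -/
def tower : ℕ → Model
  | 0 => R
  | n + 1 => (tower n).reflect

theorem Negative.tower (h : R.Negative) (n : ℕ) : (R.tower n).Negative := by
  induction n with
  | zero => exact h
  | succ n ih => exact ih.reflect

end Model

theorem Tri.univ_eq {i j l : Fin 3} (h : Tri i j l) :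
    (Finset.univ : Finset (Fin 3)) = {i, j, l} := by
  revert i j l; unfold Tri; decide

/-! ### Elementary maps and admissible elements -/

namespace Step

variable {R R' : Model} (S : Step R R') {i j l : Fin 3}
include S

theorem add_add_eq_zero (h : Tri i j l) (w : R.V) : S.φ i w + S.φ j w + S.φ l w = 0 := by
  rw [← S.sum_eq_zero w]
  have hu := h.univ_eq
  rw [hu, Finset.sum_insert (by simp [h.1, h.2.2]), Finset.sum_pair h.2.1, add_assoc]

theorem exists_lift_of_add_eq_zero (h : Tri i j l) {u v w : R.V}
    (huvw : S.φ i u + S.φ j v + S.φ l w = 0) :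
    ∃ z, S.φ i z = S.φ i u ∧ S.φ j z = S.φ j v ∧ S.φ l z = S.φ l w := by
  let f : Fin 3 → R.V := fun t => if t = i then u else if t = j then v else w
  have hi : f i = u := by simp [f]
  have hj : f j = v := by simp [f, h.1.symm]
  have hl : f l = w := by simp [f, h.2.2.symm, h.2.1.symm]
  have hu := h.univ_eq
  obtain ⟨z, hz⟩ := S.exists_lift f (by
    rw [hu, Finset.sum_insert (by simp [h.1, h.2.2]), Finset.sum_pair h.2.1, ← add_assoc, hi, hj,
      hl, huvw])
  exact ⟨z, hi ▸ hz i, hj ▸ hz j, hl ▸ hz l⟩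

theorem exists_of_mem_y {v : R'.V} (hv : v ∈ R'.y i) : ∃ w, S.φ i w = v := by
  rwa [← S.range_eq] at hv

theorem map_add_mem_y (h : Tri i j l) {w : R.V} (hw : w ∈ R.x j) : S.φ i w ∈ R'.y l := by
  have h0 := S.add_add_eq_zero h w
  rw [(S.eq_zero_iff j w).2 hw, add_zero] at h0
  rw [eq_neg_of_add_eq_zero_left h0]
  exact neg_mem (S.φ_mem l w)

/-- Modulo x_i, the kernel of φ_i, only the part v in y_j a_{n-1}^{jl} counts, and φ_i v = -φ_l v -
φ_j v is a sum of the form required by A_n^{lj}. Conversely, such a sum lifts to a single vector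
because zero-sum triples lift. -/
theorem mem_a (h : Tri i j l) (n : ℕ) {w : R.V} :
    w ∈ R.ev (a n i j) ↔ S.φ i w ∈ R'.ev (A n l j) := by
  induction n generalizing i j l w with
  | zero => simp [a_zero, A_zero]
  | succ n ih =>
    rw [a_succ h, A_succ h.rot.swap]
    simp only [Model.ev_sup, Model.ev_inf, Model.ev_x, Model.ev_y, Submodule.mem_sup,
      Submodule.mem_inf]
    constructor
    · rintro ⟨u, hu, v, ⟨hv, hv'⟩, rfl⟩
      refine ⟨-S.φ l v, neg_mem (S.φ_mem l v), -S.φ j v, ⟨neg_mem (S.mem_y.1 hv),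
        neg_mem ((ih h.rot).1 hv')⟩, ?_⟩
      have h0 := S.add_add_eq_zero h v
      rw [map_add, (S.eq_zero_iff i u).2 hu, zero_add,
        eq_neg_of_add_eq_zero_left ((add_assoc _ _ _).symm.trans h0)]
      abel
    · rintro ⟨p, hp, q, ⟨hq, hq'⟩, hpq⟩
      obtain ⟨wp, rfl⟩ := S.exists_of_mem_y hp
      obtain ⟨wq, rfl⟩ := S.exists_of_mem_y (R'.le j hq)
      obtain ⟨z, hzi, hzj, hzl⟩ := S.exists_lift_of_add_eq_zero h (u := -w) (v := wq) (w := wp)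
        (by rw [map_neg, ← hpq]; abel)
      refine ⟨w + z, ?_, -z, ⟨neg_mem (S.mem_y.2 (hzj ▸ hq)),
        neg_mem ((ih h.rot).2 (hzj ▸ hq'))⟩, by abel⟩
      rw [← S.eq_zero_iff, map_add, hzi, map_neg, add_neg_cancel]

theorem mem_A (h : Tri i j l) (n : ℕ) {w : R.V} :
    w ∈ R.ev (A n i j) ↔ S.φ i w ∈ R'.ev (a n i l) := by
  induction n generalizing i j l w with
  | zero => simp [a_zero, A_zero]
  | succ n ih =>
    rw [A_succ h, a_succ h.rot.rot.swap]
    simp only [Model.ev_sup, Model.ev_inf, Model.ev_x, Model.ev_y, Submodule.mem_sup,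
      Submodule.mem_inf]
    constructor
    · rintro ⟨u, hu, v, ⟨hv, hv'⟩, rfl⟩
      refine ⟨S.φ i u, S.mem_y.1 hu, S.φ i v, ⟨S.map_add_mem_y h hv, ?_⟩, (map_add _ _ _).symm⟩
      have h0 := S.add_add_eq_zero h v
      rw [(S.eq_zero_iff j v).2 hv, add_zero] at h0
      rw [eq_neg_of_add_eq_zero_left h0]
      exact neg_mem ((ih h.rot.rot).1 hv')
    · rintro ⟨p, hp, q, ⟨hq, hq'⟩, hpq⟩
      obtain ⟨wp, rfl⟩ := S.exists_of_mem_y (R'.le i hp)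
      obtain ⟨t, rfl⟩ := S.exists_of_mem_y hq
      obtain ⟨z, hzi, hzj, hzl⟩ := S.exists_lift_of_add_eq_zero h (u := w - wp) (v := 0) (w := -t)
        (by rw [map_neg, map_sub, ← hpq, map_zero]; abel)
      refine ⟨w - z, ?_, z, ⟨?_, ?_⟩, by abel⟩
      · rw [S.mem_y, map_sub, hzi, map_sub, sub_sub_cancel]; exact hp
      · rw [← S.eq_zero_iff, hzj, map_zero]
      · rw [ih h.rot.rot, hzl, map_neg]; exact neg_mem hq'

theorem mem_x_sup_x (h : Tri i j l) {w : R.V} :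
    w ∈ R.x i ⊔ R.x j ↔ S.φ i w ∈ R'.y l ∧ S.φ j w ∈ R'.y l := by
  rw [Submodule.mem_sup]
  constructor
  · rintro ⟨u, hu, v, hv, rfl⟩
    rw [map_add, map_add, (S.eq_zero_iff i u).2 hu, (S.eq_zero_iff j v).2 hv, zero_add, add_zero]
    exact ⟨S.map_add_mem_y h hv, S.map_add_mem_y h.swap hu⟩
  · rintro ⟨hi, hj⟩
    obtain ⟨t, ht⟩ := S.exists_of_mem_y hi
    obtain ⟨z, hzi, hzj, hzl⟩ := S.exists_lift_of_add_eq_zero h (u := w) (v := 0) (w := -t)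
      (by rw [map_neg, map_zero, ht]; abel)
    refine ⟨w - z, ?_, z, ?_, by abel⟩
    · rw [← S.eq_zero_iff, map_sub, hzi, sub_self]
    · rw [← S.eq_zero_iff, hzj, map_zero]

/-- The image of a subspace that is given by conditions on the three elementary maps. -/
theorem map_eq_of_mem_iff (h : Tri i j l) {T : Submodule ℚ R.V} {s₁ s₂ s₃ : D222}
    (hT : ∀ w, w ∈ T ↔ S.φ i w ∈ R'.ev s₁ ∧ S.φ j w ∈ R'.ev s₂ ∧ S.φ l w ∈ R'.ev s₃) :
    T.map (S.φ l) = R'.ev ((y l ⊓ s₃) ⊓ ((y i ⊓ s₁) ⊔ (y j ⊓ s₂))) := by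
  ext v
  simp only [Model.ev_sup, Model.ev_inf, Model.ev_y, Submodule.mem_sup, Submodule.mem_inf,
    Submodule.mem_map, hT]
  constructor
  · rintro ⟨w, ⟨h₁, h₂, h₃⟩, rfl⟩
    refine ⟨⟨S.φ_mem l w, h₃⟩, -S.φ i w, ⟨neg_mem (S.φ_mem i w), neg_mem h₁⟩, -S.φ j w,
      ⟨neg_mem (S.φ_mem j w), neg_mem h₂⟩, ?_⟩
    rw [eq_neg_of_add_eq_zero_right (S.add_add_eq_zero h w)]
    abel
  · rintro ⟨⟨hv, h₃⟩, p, ⟨hp, h₁⟩, q, ⟨hq, h₂⟩, rfl⟩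
    obtain ⟨wp, rfl⟩ := S.exists_of_mem_y hp
    obtain ⟨wq, rfl⟩ := S.exists_of_mem_y hq
    obtain ⟨t, ht⟩ := S.exists_of_mem_y hv
    obtain ⟨z, hzi, hzj, hzl⟩ := S.exists_lift_of_add_eq_zero h (u := -wp) (v := -wq) (w := t)
      (by rw [map_neg, map_neg, ht]; abel)
    refine ⟨z, ⟨?_, ?_, ?_⟩, hzl.trans ht⟩
    · rw [hzi, map_neg]; exact neg_mem h₁
    · rw [hzj, map_neg]; exact neg_mem h₂
    · rw [hzl, ht]; exact h₃

theorem mem_P (h : Tri i j l) {α β γ δ : ℕ} {w : R.V} : w ∈ R.ev (P i j l α β γ δ) ↔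
    S.φ i w ∈ R'.ev (a γ i j ⊓ A δ j l) ∧ S.φ j w ∈ R'.ev (x j ⊓ A β l i) ∧
      S.φ l w ∈ R'.ev (a α l i) := by
  simp only [P, Model.ev_inf, Submodule.mem_inf, Model.ev_y, S.mem_y,
    S.mem_A h.rot.swap, S.mem_a h.swap, S.mem_A h.rot.rot.swap, S.mem_a h.rot.rot.swap, Model.ev_x]
  tauto

theorem mem_Q (h : Tri i j l) {α β γ δ : ℕ} {w : R.V} : w ∈ R.ev (Q i j l α β γ δ) ↔
    S.φ i w ∈ R'.ev (a β i l ⊓ A γ l j) ∧ S.φ j w ∈ R'.ev (a δ j i) ∧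
      S.φ l w ∈ R'.ev (x l ⊓ A α j i) := by
  simp only [Q, Model.ev_inf, Submodule.mem_inf, Model.ev_y, S.mem_y,
    S.mem_a h.rot.rot, S.mem_A h, S.mem_a h, S.mem_A h.rot, Model.ev_x]
  tauto

theorem mem_G (h : Tri i j l) {q k : ℕ} {w : R.V} : w ∈ R.ev (G i j l q k) ↔
    S.φ i w ∈ R'.ev (x i ⊓ A q j l) ∧ S.φ j w ∈ R'.ev (x j) ∧ S.φ l w ∈ R'.ev (a k l i) := by
  simp only [G, Model.ev_inf, Submodule.mem_inf, Model.ev_y, S.mem_y, S.mem_a h.rot.rot.swap,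
    S.mem_A h.rot.swap, Model.ev_x]
  tauto

theorem mem_M (h : Tri i j l) {q k : ℕ} {w : R.V} : w ∈ R.ev (M i j l q k) ↔
    S.φ i w ∈ R'.ev (y l) ∧ S.φ j w ∈ R'.ev (y l ⊓ a q j i) ∧
      S.φ l w ∈ R'.ev (x l ⊓ A k j i) := by
  simp only [M, Model.ev_inf, Submodule.mem_inf, Model.ev_y, S.mem_y, Model.ev_sup, Model.ev_x,
    S.mem_x_sup_x h, S.mem_A h.rot, S.mem_a h.rot.rot]
  tauto

theorem mem_N (h : Tri i j l) {q k : ℕ} {w : R.V} : w ∈ R.ev (N i j l q k) ↔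
    S.φ i w ∈ R'.ev (a q i l ⊓ A k l j) ∧ S.φ j w ∈ R'.ev ⊤ ∧ S.φ l w = 0 := by
  simp only [N, Model.ev_inf, Submodule.mem_inf, Model.ev_x, S.eq_zero_iff, S.mem_A h, S.mem_a h,
    Model.ev_top, Submodule.mem_top]
  tauto

end Step

/-! ### Images of the shapes under single elementary maps -/

namespace Step

variable {R R' : Model} (S : Step R R') {i j l : Fin 3}

section Shapes

variable {q k q' k' α β γ δ α' β' γ' δ' : ℕ}

include S

/-- As in the other image lemmas for P and Q, the modular law folds the sum from `map_eq_of_mem_iff`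
into an atomic element with lower index raised by one. The parameters are tied by equations, so that
the index arithmetic of the tables can be left to `omega`. -/
theorem map_P_third (h : Tri i j l) (hα : α' = α) (hβ : β' = β + 1) (hγ : γ' = γ) (hδ : δ' = δ) :
    (R.ev (P i j l α β γ δ)).map (S.φ l) = R'.ev (Q i j l α' β' γ' δ') := by
  rw [hα, hβ, hγ, hδ]
  rw [S.map_eq_of_mem_iff h fun w => S.mem_P h]
  congr 1
  have hr : y j ⊓ (x j ⊓ A β l i) = x j ⊓ A β l i :=
    inf_eq_right.2 (inf_le_left.trans (x_le_y j))
  have hU : x j ⊓ A β l i ≤ a γ i j ⊓ A δ j l :=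
    inf_le_left.trans (le_inf (x_snd_le_a _ _ _) (x_le_A _ _ _))
  rw [hr, inf_comm (y i), inf_sup_assoc_of_le _ hU, ← A_succ h, Q]
  ac_rfl

theorem map_P_first (h : Tri i j l) (hα : α' = γ) (hβ : β' = δ) (hγ : γ' = α + 1) (hδ : δ' = β) :
    (R.ev (P i j l α β γ δ)).map (S.φ i) = R'.ev (Q j l i α' β' γ' δ') := by
  rw [hα, hβ, hγ, hδ]
  rw [S.map_eq_of_mem_iff h.rot fun w => (S.mem_P h).trans and_comm |>.trans and_assoc]
  congr 1
  have hr : y j ⊓ (x j ⊓ A β l i) = A β l i ⊓ x j := by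
    rw [inf_eq_right.2 (inf_le_left.trans (x_le_y j)), inf_comm]
  have hU : y l ⊓ a α l i ≤ A β l i := inf_le_left.trans (y_le_A _ _ _)
  rw [hr, inf_sup_assoc_of_le _ hU, ← a_succ h.rot, Q]
  ac_rfl

theorem map_Q_first (h : Tri i j l) (hα : α' = α) (hβ : β' = β) (hγ : γ' = γ) (hδ : δ' = δ + 1) :
    (R.ev (Q i j l α β γ δ)).map (S.φ i) = R'.ev (P l i j α' β' γ' δ') := by
  rw [hα, hβ, hγ, hδ]
  rw [S.map_eq_of_mem_iff h.rot fun w => (S.mem_Q h).trans and_comm |>.trans and_assoc]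
  congr 1
  have hr : y l ⊓ (x l ⊓ A α j i) = A α j i ⊓ x l := by
    rw [inf_eq_right.2 (inf_le_left.trans (x_le_y l)), inf_comm]
  have hU : y j ⊓ a δ j i ≤ A α j i := inf_le_left.trans (y_le_A _ _ _)
  rw [hr, sup_comm, inf_sup_assoc_of_le _ hU, ← a_succ h.rot.swap, P]
  ac_rfl

theorem map_Q_second (h : Tri i j l) (hα : α' = γ) (hβ : β' = δ) (hγ : γ' = α + 1) (hδ : δ' = β) :
    (R.ev (Q i j l α β γ δ)).map (S.φ j) = R'.ev (P i j l α' β' γ' δ') := by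
  rw [hα, hβ, hγ, hδ]
  rw [S.map_eq_of_mem_iff h.rot.rot fun w =>
    (S.mem_Q h).trans (and_assoc.symm.trans and_comm)]
  congr 1
  have hr : y l ⊓ (x l ⊓ A α j i) = x l ⊓ A α j i :=
    inf_eq_right.2 (inf_le_left.trans (x_le_y l))
  have hU : x l ⊓ A α j i ≤ a β i l ⊓ A γ l j :=
    inf_le_left.trans (le_inf (x_snd_le_a _ _ _) (x_le_A _ _ _))
  rw [hr, sup_comm, inf_comm (y i), inf_sup_assoc_of_le _ hU, ← A_succ h.rot.rot.swap, P]
  ac_rfl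

theorem map_G_third (h : Tri i j l) (hq : q' = q) (hk : k' = k) :
    (R.ev (G i j l q k)).map (S.φ l) = R'.ev (M i j l q' k') := by
  subst hq hk
  rw [S.map_eq_of_mem_iff h fun w => S.mem_G h]
  congr 1
  have hr : y i ⊓ (x i ⊓ A q' j l) = A q' j l ⊓ x i := by
    rw [inf_eq_right.2 (inf_le_left.trans (x_le_y i)), inf_comm]
  rw [hr, inf_eq_right.2 (x_le_y j), inf_sup_assoc_of_le _ (x_le_A _ _ _), M]
  ac_rfl

theorem map_G_first (h : Tri i j l) (hq : q' = q) (hk : k' = k + 1) :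
    (R.ev (G i j l q k)).map (S.φ i) = R'.ev (N j l i q' k') := by
  subst hq hk
  rw [S.map_eq_of_mem_iff h.rot fun w => (S.mem_G h).trans and_comm |>.trans and_assoc]
  congr 1
  rw [inf_eq_right.2 (inf_le_left.trans (x_le_y i)), inf_eq_right.2 (x_le_y j), ← a_succ h.rot, N]

theorem map_G_second (h : Tri i j l) (hq : q' = q + 1) (hk : k' = k) :
    (R.ev (G i j l q k)).map (S.φ j) = R'.ev (N l i j q' k') := by
  subst hq hk
  rw [S.map_eq_of_mem_iff h.rot.rot fun w =>
    (S.mem_G h).trans (and_assoc.symm.trans and_comm)]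
  congr 1
  have hr : y i ⊓ (x i ⊓ A q j l) = x i ⊓ A q j l :=
    inf_eq_right.2 (inf_le_left.trans (x_le_y i))
  have hU : x i ⊓ A q j l ≤ a k' l i := inf_le_left.trans (x_snd_le_a _ _ _)
  rw [hr, inf_eq_right.2 (x_le_y j), inf_comm (y l), inf_sup_assoc_of_le _ hU,
    ← A_succ h.rot.rot, N]
  ac_rfl

theorem map_M_first (h : Tri i j l) (hq : q' = q + 1) (hk : k' = k) :
    (R.ev (M i j l q k)).map (S.φ i) = R'.ev (G l i j q' k') := by
  subst hq hk
  rw [S.map_eq_of_mem_iff h.rot fun w => (S.mem_M h).trans and_comm |>.trans and_assoc]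
  congr 1
  have hr : y l ⊓ (x l ⊓ A k' j i) = A k' j i ⊓ x l := by
    rw [inf_eq_right.2 (inf_le_left.trans (x_le_y l)), inf_comm]
  have hl : A k' j i ⊓ x l ≤ y l := inf_le_right.trans (x_le_y l)
  have hU : y j ⊓ a q j i ≤ A k' j i := inf_le_left.trans (y_le_A _ _ _)
  rw [hr, inf_left_comm, inf_sup_assoc_of_le _ hl, sup_comm, inf_sup_assoc_of_le _ hU,
    ← a_succ h.rot.swap, G]
  rw [show y i ⊓ y l ⊓ (y l ⊓ (A k' j i ⊓ a (q + 1) l j)) =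
    (y l ⊓ y l) ⊓ y i ⊓ a (q + 1) l j ⊓ A k' j i by ac_rfl, inf_idem]

theorem map_M_second (h : Tri i j l) (hq : q' = q) (hk : k' = k + 1) :
    (R.ev (M i j l q k)).map (S.φ j) = R'.ev (G j l i q' k') := by
  subst hq hk
  rw [S.map_eq_of_mem_iff h.rot.rot fun w =>
    (S.mem_M h).trans (and_assoc.symm.trans and_comm)]
  congr 1
  have hr : y l ⊓ (x l ⊓ A k j i) = x l ⊓ A k j i :=
    inf_eq_right.2 (inf_le_left.trans (x_le_y l))
  have hU : x l ⊓ A k j i ≤ y l := inf_le_left.trans (x_le_y l)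
  rw [hr, sup_comm, inf_comm (y i), inf_sup_assoc_of_le _ hU, ← A_succ h.rot.rot.swap, G]
  rw [show y j ⊓ (y l ⊓ a q' j i) ⊓ (y l ⊓ A (k + 1) i l) =
    y j ⊓ (y l ⊓ y l) ⊓ a q' j i ⊓ A (k + 1) i l by ac_rfl, inf_idem]

/-- The condition φ_l w = 0 becomes a lattice element, as `map_eq_of_mem_iff` demands; negativity
makes the bottom element evaluate to zero. -/
theorem mem_N_bot (hR : R'.Negative) (h : Tri i j l) {w : R.V} : w ∈ R.ev (N i j l q k) ↔
    S.φ i w ∈ R'.ev (a q i l ⊓ A k l j) ∧ S.φ j w ∈ R'.ev ⊤ ∧ S.φ l w ∈ R'.ev ⊥ := by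
  rw [S.mem_N h, hR.ev_bot, Submodule.mem_bot]

theorem map_N_first (hR : R'.Negative) (h : Tri i j l) (hq : q' = q) (hk : k' = k) :
    (R.ev (N i j l q k)).map (S.φ i) = R'.ev (G i j l q' k') := by
  subst hq hk
  rw [S.map_eq_of_mem_iff h.rot fun w => (S.mem_N_bot hR h).trans and_comm |>.trans and_assoc]
  congr 1
  rw [inf_bot_eq, sup_bot_eq, inf_top_eq, G]
  ac_rfl

theorem map_N_second (hR : R'.Negative) (h : Tri i j l) (hq : q' = q) (hk : k' = k) :
    (R.ev (N i j l q k)).map (S.φ j) = R'.ev (G i j l q' k') := by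
  subst hq hk
  rw [S.map_eq_of_mem_iff h.rot.rot fun w =>
    (S.mem_N_bot hR h).trans (and_assoc.symm.trans and_comm)]
  congr 1
  rw [inf_bot_eq, bot_sup_eq, inf_top_eq, G]
  ac_rfl

end Shapes

/-- The elementary map `c` sends the admissible elements with parameters `k`, `p`, `r` to some
admissible elements of the next length. -/
def Sends (i j l : Fin 3) (k p : ℕ) (r : Fin 14) (c : Fin 3) (k' p' : ℕ) (r' : Fin 14) : Prop :=
  (R.ev (f i j l k p r)).map (S.φ c) = R'.ev (f i j l k' p' r') ∧
    (R.ev (e i j l k p r)).map (S.φ c) = R'.ev (e i j l k' p' r')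

/-- Here the map φ_c puts the letter c in front of the sequence; at types 5 and 13 this completes a
further block (jil)^2 and raises p. -/
theorem sends_fst (h : Tri i j l) (hR : R'.Negative) (k p : ℕ) :
    S.Sends i j l (k + 1) p 0 l (k + 1) p 1 ∧
    S.Sends i j l (k + 1) p 1 i (k + 1) p 2 ∧
    S.Sends i j l (k + 1) p 2 j (k + 1) p 3 ∧
    S.Sends i j l (k + 1) p 3 l (k + 1) p 4 ∧
    S.Sends i j l (k + 1) p 4 i (k + 1) p 5 ∧
    S.Sends i j l (k + 1) p 5 j (k + 1) (p + 1) 0 ∧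
    S.Sends i j l k p 6 j k 0 8 ∧
    S.Sends i j l k p 7 j (k + 1) 0 0 ∧
    S.Sends i j l k p 8 l k p 9 ∧
    S.Sends i j l k p 9 i k p 10 ∧
    S.Sends i j l k p 10 j k p 11 ∧
    S.Sends i j l k p 11 l k p 12 ∧
    S.Sends i j l k p 12 i k p 13 ∧
    S.Sends i j l k p 13 j k (p + 1) 8 := by
  simp only [Sends, f_eq, e_eq]
  refine ⟨⟨S.map_G_third h ?_ ?_, S.map_P_third h ?_ ?_ ?_ ?_⟩,
    ⟨S.map_M_first h ?_ ?_, S.map_Q_first h ?_ ?_ ?_ ?_⟩,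
    ⟨S.map_G_third h.rot.rot ?_ ?_, S.map_P_third h.rot.rot ?_ ?_ ?_ ?_⟩,
    ⟨S.map_M_first h.rot.rot ?_ ?_, S.map_Q_first h.rot.rot ?_ ?_ ?_ ?_⟩,
    ⟨S.map_G_third h.rot ?_ ?_, S.map_P_third h.rot ?_ ?_ ?_ ?_⟩,
    ⟨S.map_M_first h.rot ?_ ?_, S.map_Q_first h.rot ?_ ?_ ?_ ?_⟩,
    ⟨S.map_N_first hR h.rot ?_ ?_, S.map_Q_first h.rot ?_ ?_ ?_ ?_⟩,
    ⟨S.map_M_first h.rot ?_ ?_, S.map_Q_first h.rot ?_ ?_ ?_ ?_⟩,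
    ⟨S.map_G_second h.rot ?_ ?_, S.map_P_third h ?_ ?_ ?_ ?_⟩,
    ⟨S.map_N_first hR h ?_ ?_, S.map_Q_first h ?_ ?_ ?_ ?_⟩,
    ⟨S.map_G_second h ?_ ?_, S.map_P_third h.rot.rot ?_ ?_ ?_ ?_⟩,
    ⟨S.map_N_first hR h.rot.rot ?_ ?_, S.map_Q_first h.rot.rot ?_ ?_ ?_ ?_⟩,
    ⟨S.map_G_second h.rot.rot ?_ ?_, S.map_P_third h.rot ?_ ?_ ?_ ?_⟩,
    ⟨S.map_N_first hR h.rot ?_ ?_, S.map_Q_first h.rot ?_ ?_ ?_ ?_⟩⟩ <;> omega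

/-- A second map also yields an admissible element, in general indexed by a word other than c
followed by the source. Types 6 and 7 are absent as sources; `Model.Symmetric` replaces the missing
map. -/
theorem sends_snd (h : Tri i j l) (hR : R'.Negative) (k p : ℕ) :
    S.Sends i j l (k + 1) (p + 1) 0 i (k + 1) p 13 ∧
    S.Sends i j l (k + 1) 0 0 i (k + 1) p 6 ∧
    S.Sends i j l (k + 1) p 1 j (k + 1) p 8 ∧
    S.Sends i j l (k + 1) p 2 l (k + 1) p 9 ∧
    S.Sends i j l (k + 1) p 3 i (k + 1) p 10 ∧
    S.Sends i j l (k + 1) p 4 j (k + 1) p 11 ∧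
    S.Sends i j l (k + 1) p 5 l (k + 1) p 12 ∧
    S.Sends i j l k (p + 1) 8 i (k + 1) p 5 ∧
    S.Sends i j l k 0 8 i k p 7 ∧
    S.Sends i j l k p 9 j (k + 1) p 0 ∧
    S.Sends i j l k p 10 l (k + 1) p 1 ∧
    S.Sends i j l k p 11 i (k + 1) p 2 ∧
    S.Sends i j l k p 12 j (k + 1) p 3 ∧
    S.Sends i j l k p 13 l (k + 1) p 4 := by
  simp only [Sends, f_eq, e_eq]
  refine ⟨⟨S.map_G_first h ?_ ?_, S.map_P_first h ?_ ?_ ?_ ?_⟩,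
    ⟨S.map_G_first h ?_ ?_, S.map_P_first h ?_ ?_ ?_ ?_⟩,
    ⟨S.map_M_second h ?_ ?_, S.map_Q_second h ?_ ?_ ?_ ?_⟩,
    ⟨S.map_G_first h.rot.rot ?_ ?_, S.map_P_first h.rot.rot ?_ ?_ ?_ ?_⟩,
    ⟨S.map_M_second h.rot.rot ?_ ?_, S.map_Q_second h.rot.rot ?_ ?_ ?_ ?_⟩,
    ⟨S.map_G_first h.rot ?_ ?_, S.map_P_first h.rot ?_ ?_ ?_ ?_⟩,
    ⟨S.map_M_second h.rot ?_ ?_, S.map_Q_second h.rot ?_ ?_ ?_ ?_⟩,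
    ⟨S.map_G_third h.rot ?_ ?_, S.map_P_first h ?_ ?_ ?_ ?_⟩,
    ⟨S.map_G_third h.rot ?_ ?_, S.map_P_first h ?_ ?_ ?_ ?_⟩,
    ⟨S.map_N_second hR h ?_ ?_, S.map_Q_second h ?_ ?_ ?_ ?_⟩,
    ⟨S.map_G_third h ?_ ?_, S.map_P_first h.rot.rot ?_ ?_ ?_ ?_⟩,
    ⟨S.map_N_second hR h.rot.rot ?_ ?_, S.map_Q_second h.rot.rot ?_ ?_ ?_ ?_⟩,
    ⟨S.map_G_third h.rot.rot ?_ ?_, S.map_P_first h.rot ?_ ?_ ?_ ?_⟩,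
    ⟨S.map_N_second hR h.rot ?_ ?_, S.map_Q_second h.rot ?_ ?_ ?_ ?_⟩⟩ <;> omega

end Step

/-! ### Cumulative elements under the elementary maps -/

theorem type_lt_cases {r : Fin 14} (h : r < 6) :
    r = 0 ∨ r = 1 ∨ r = 2 ∨ r = 3 ∨ r = 4 ∨ r = 5 := by
  revert r; decide

theorem type_ge_cases {r : Fin 14} (h : ¬ r < 6) :
    r = 6 ∨ r = 7 ∨ r = 8 ∨ r = 9 ∨ r = 10 ∨ r = 11 ∨ r = 12 ∨ r = 13 := by
  revert r; decide

theorem f_le_cumX {t : Fin 3} {n : ℕ} {σ : Equiv.Perm (Fin 3)} {r : Fin 14} {k p : ℕ}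
    (hs : (σ, r, k, p) ∈ params t n) : f (σ 0) (σ 1) (σ 2) k p r ≤ cumX t n := by
  have h := Finset.le_sup (f := fun s : Equiv.Perm (Fin 3) × Fin 14 × ℕ × ℕ =>
    f (s.1 0) (s.1 1) (s.1 2) s.2.2.1 s.2.2.2 s.2.1) hs
  rw [cumX]
  exact h

theorem e_le_cumY {t : Fin 3} {n : ℕ} {σ : Equiv.Perm (Fin 3)} {r : Fin 14} {k p : ℕ}
    (hs : (σ, r, k, p) ∈ params t n) : e (σ 0) (σ 1) (σ 2) k p r ≤ cumY t n := by
  have h := Finset.le_sup (f := fun s : Equiv.Perm (Fin 3) × Fin 14 × ℕ × ℕ =>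
    e (s.1 0) (s.1 1) (s.1 2) s.2.2.1 s.2.2.2 s.2.1) hs
  rw [cumY]
  exact h

namespace Model

variable {R : Model}

theorem Negative.ev_finset_sup (h : R.Negative) {ι : Type*} (s : Finset ι) (g : ι → D222) :
    R.ev (s.sup g) = s.sup fun i => R.ev (g i) :=
  Finset.apply_sup_eq_sup_comp R.ev (fun _ _ => R.ev_sup _ _) h.ev_bot

end Model

namespace Step

variable {R R' : Model} (S : Step R R')

/-- Every admissible element of length at least two is the image of a shorter one. -/
theorem exists_sends (hR : R'.Negative) {t : Fin 3} {n : ℕ} (hn : 1 ≤ n)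
    {σ : Equiv.Perm (Fin 3)} {r : Fin 14} {k p : ℕ} (hs : (σ, r, k, p) ∈ params t (n + 1)) :
    ∃ r' k' p' c, (σ, r', k', p') ∈ params t n ∧
      S.Sends (σ 0) (σ 1) (σ 2) k' p' r' c k p r := by
  have h := tri_perm σ
  obtain ⟨⟨hkn, hpn⟩, h₀, hr, hlen⟩ := mem_params.1 hs
  simp only [mem_params]
  by_cases hr6 : r < 6
  · obtain ⟨k, rfl⟩ := Nat.exists_eq_succ_of_ne_zero (hr hr6).ne'
    obtain ⟨s₀, s₁, s₂, s₃, s₄, -⟩ := S.sends_fst h hR k p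
    obtain rfl | rfl | rfl | rfl | rfl | rfl := type_lt_cases hr6 <;> simp [len] at hlen
    · rcases p with - | p
      · exact ⟨7, k, 0, _, ⟨by omega, h₀, by simp, by simp [len]; omega⟩,
          (S.sends_fst h hR k 0).2.2.2.2.2.2.2.1⟩
      · exact ⟨5, k + 1, p, _, ⟨by omega, h₀, by simp, by simp [len]; omega⟩,
          (S.sends_fst h hR k p).2.2.2.2.2.1⟩
    · exact ⟨0, k + 1, p, _, ⟨by omega, h₀, by simp, by simp [len]; omega⟩, s₀⟩
    · exact ⟨1, k + 1, p, _, ⟨by omega, h₀, by simp, by simp [len]; omega⟩, s₁⟩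
    · exact ⟨2, k + 1, p, _, ⟨by omega, h₀, by simp, by simp [len]; omega⟩, s₂⟩
    · exact ⟨3, k + 1, p, _, ⟨by omega, h₀, by simp, by simp [len]; omega⟩, s₃⟩
    · exact ⟨4, k + 1, p, _, ⟨by omega, h₀, by simp, by simp [len]; omega⟩, s₄⟩
  · obtain ⟨-, -, -, -, -, -, -, -, s₈, s₉, s₁₀, s₁₁, s₁₂, -⟩ := S.sends_fst h hR k p
    obtain rfl | rfl | rfl | rfl | rfl | rfl | rfl | rfl := type_ge_cases hr6 <;>
      simp [len] at hlen
    · obtain ⟨k, rfl⟩ := Nat.exists_eq_succ_of_ne_zero (show k ≠ 0 by omega)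
      exact ⟨0, k + 1, 0, _, ⟨by omega, h₀, by simp, by simp [len]; omega⟩,
        (S.sends_snd h hR k p).2.1⟩
    · exact ⟨8, k, 0, _, ⟨by omega, h₀, by simp, by simp [len]; omega⟩,
        (S.sends_snd h hR k p).2.2.2.2.2.2.2.2.1⟩
    · rcases p with - | p
      · exact ⟨6, k, 0, _, ⟨by omega, h₀, by simp, by simp [len]; omega⟩,
          (S.sends_fst h hR k 0).2.2.2.2.2.2.1⟩
      · exact ⟨13, k, p, _, ⟨by omega, h₀, by simp, by simp [len]; omega⟩,
          (S.sends_fst h hR k p).2.2.2.2.2.2.2.2.2.2.2.2.2⟩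
    · exact ⟨8, k, p, _, ⟨by omega, h₀, by simp, by simp [len]; omega⟩, s₈⟩
    · exact ⟨9, k, p, _, ⟨by omega, h₀, by simp, by simp [len]; omega⟩, s₉⟩
    · exact ⟨10, k, p, _, ⟨by omega, h₀, by simp, by simp [len]; omega⟩, s₁₀⟩
    · exact ⟨11, k, p, _, ⟨by omega, h₀, by simp, by simp [len]; omega⟩, s₁₁⟩
    · exact ⟨12, k, p, _, ⟨by omega, h₀, by simp, by simp [len]; omega⟩, s₁₂⟩


theorem cumX_eq_bot (S : Step R R') (hR : R.Negative) (hR' : R'.Negative) {t : Fin 3} {n : ℕ} (hn : 1 ≤ n)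
    (h : R.ev (cumX t n) = ⊥) : R'.ev (cumX t (n + 1)) = ⊥ := by
  rw [cumX, hR'.ev_finset_sup, Finset.sup_eq_bot_iff]
  rw [cumX, hR.ev_finset_sup, Finset.sup_eq_bot_iff] at h
  rintro ⟨σ, r, k, p⟩ hs
  obtain ⟨r', k', p', c, hs', hc⟩ := S.exists_sends hR' hn hs
  rw [← hc.1, h _ hs', Submodule.map_bot]

theorem cumY_eq_bot (S : Step R R') (hR : R.Negative) (hR' : R'.Negative) {t : Fin 3} {n : ℕ} (hn : 1 ≤ n)
    (h : R.ev (cumY t n) = ⊥) : R'.ev (cumY t (n + 1)) = ⊥ := by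
  rw [cumY, hR'.ev_finset_sup, Finset.sup_eq_bot_iff]
  rw [cumY, hR.ev_finset_sup, Finset.sup_eq_bot_iff] at h
  rintro ⟨σ, r, k, p⟩ hs
  obtain ⟨r', k', p', c, hs', hc⟩ := S.exists_sends hR' hn hs
  rw [← hc.2, h _ hs', Submodule.map_bot]

/-- Since the three maps add up to zero, control of two of them controls the third. -/
theorem map_le_of_two {c c' : Fin 3} (hc : c ≠ c') {U : Submodule ℚ R.V} {B : Submodule ℚ R'.V}
    (h : U.map (S.φ c) ≤ B) (h' : U.map (S.φ c') ≤ B) (d : Fin 3) : U.map (S.φ d) ≤ B := by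
  have hd : d = c ∨ d = c' ∨ Tri c c' d := by
    clear h h'; revert c c' d; unfold Tri; decide
  rcases hd with rfl | rfl | ht
  · exact h
  · exact h'
  · rintro _ ⟨w, hw, rfl⟩
    rw [eq_neg_of_add_eq_zero_right (S.add_add_eq_zero ht w)]
    exact neg_mem (add_mem (h ⟨w, hw, rfl⟩) (h' ⟨w, hw, rfl⟩))

theorem Sends.le_cum {S : Step R R'} {t : Fin 3} {N : ℕ} {σ : Equiv.Perm (Fin 3)}
    {r r' : Fin 14} {k p k' p' : ℕ} {c : Fin 3}
    (h : S.Sends (σ 0) (σ 1) (σ 2) k p r c k' p' r') (hs : (σ, r', k', p') ∈ params t N) :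
    (R.ev (f (σ 0) (σ 1) (σ 2) k p r)).map (S.φ c) ≤ R'.ev (cumX t N) ∧
      (R.ev (e (σ 0) (σ 1) (σ 2) k p r)).map (S.φ c) ≤ R'.ev (cumY t N) := by
  rw [h.1, h.2]
  exact ⟨R'.ev_mono (f_le_cumX hs), R'.ev_mono (e_le_cumY hs)⟩

/-- Applying φ_i twice kills y_i: the first map sends it into the new x_i, the kernel of the second.
The relation of sum zero then makes the two composites opposite. -/
theorem map_map_eq {R'' : Model} (S' : Step R' R'') {i j l : Fin 3} (h : Tri i j l)
    {U : Submodule ℚ R.V} (hU : U ≤ R.y i) :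
    (U.map (S.φ j)).map (S'.φ i) = (U.map (S.φ l)).map (S'.φ i) := by
  have key : ∀ w ∈ U, S'.φ i (S.φ l w) = -S'.φ i (S.φ j w) := by
    intro w hw
    have h0 : S'.φ i (S.φ i w) = 0 := by
      have h₁ : S.φ i w ∈ R'.x i := S.mem_y.1 (hU hw)
      exact (S'.eq_zero_iff _ _).2 h₁
    have h₂ := congrArg (S'.φ i) (S.add_add_eq_zero h w)
    rw [map_add, map_add, h0, zero_add, map_zero] at h₂
    exact eq_neg_of_add_eq_zero_right h₂
  ext v
  simp only [Submodule.mem_map, exists_exists_and_eq_and]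
  constructor
  · rintro ⟨w, hw, rfl⟩
    exact ⟨-w, neg_mem hw, by rw [map_neg, map_neg, key w hw, neg_neg]⟩
  · rintro ⟨w, hw, rfl⟩
    exact ⟨-w, neg_mem hw, by rw [map_neg, map_neg, key w hw]⟩

end Step

/-- The admissible elements of type `r` do not change when the last two indices are swapped. -/
def Model.Symmetric (R : Model) (i j l : Fin 3) (k p : ℕ) (r : Fin 14) : Prop :=
  R.ev (f i j l k p r) = R.ev (f i l j k p r) ∧ R.ev (e i j l k p r) = R.ev (e i l j k p r)

theorem Step.Sends.symmetric {R R' R'' : Model} {S : Step R R'} {S' : Step R' R''}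
    {i j l : Fin 3} (h : Tri i j l) {k k' k'' p p' p'' : ℕ} {r r' r'' : Fin 14}
    (s₁ : S.Sends i j l k p r j k' p' r') (s₂ : S'.Sends i j l k' p' r' i k'' p'' r'')
    (t₁ : S.Sends i l j k p r l k' p' r') (t₂ : S'.Sends i l j k' p' r' i k'' p'' r'')
    (hf : f i j l k p r ≤ y i) (he : e i j l k p r ≤ y i) (hs : R.Symmetric i j l k p r) :
    R''.Symmetric i j l k'' p'' r'' := by
  constructor
  · rw [← s₂.1, ← s₁.1, ← t₂.1, ← t₁.1, ← hs.1]
    exact S.map_map_eq S' h (R.ev_mono hf)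
  · rw [← s₂.2, ← s₁.2, ← t₂.2, ← t₁.2, ← hs.2]
    exact S.map_map_eq S' h (R.ev_mono he)

/-- A sequence of representations, each with elementary maps to the next one. -/
structure Tower (R : ℕ → Model) where
  negative : ∀ n, (R n).Negative
  /-- The elementary maps. -/
  step : ∀ n, Step (R n) (R (n + 1))

/-- The tower of the iterated reflections of a representation. -/
def Model.Negative.toTower {R : Model} (h : R.Negative) : Tower R.tower where
  negative := h.tower
  step n := (h.tower n).step

theorem f_six_le (i j l : Fin 3) (k p : ℕ) : f i j l k p 6 ≤ y i := by
  rw [f_eq]; exact inf_le_left.trans (inf_le_left.trans (x_le_y i))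

theorem f_seven_le (i j l : Fin 3) (k p : ℕ) : f i j l k p 7 ≤ y i := by
  rw [f_eq]; exact inf_le_left.trans (inf_le_left.trans inf_le_left)

theorem e_six_le (i j l : Fin 3) (k p : ℕ) : e i j l k p 6 ≤ y i := by
  rw [e_eq]; exact inf_le_left.trans (inf_le_left.trans (inf_le_left.trans inf_le_left))

theorem e_seven_le (i j l : Fin 3) (k p : ℕ) : e i j l k p 7 ≤ y i := by
  rw [e_eq]; exact inf_le_left.trans (inf_le_left.trans (inf_le_left.trans inf_le_left))

/-! ### Values of cumulative elements along a tower -/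

namespace Tower

variable {R : ℕ → Model} (T : Tower R)
include T

theorem symmetric {i j l : Fin 3} (ht : Tri i j l) (k p : ℕ) :
    (R (4 * k)).Symmetric i j l k p 6 ∧ (R (4 * k + 2)).Symmetric i j l k p 7 := by
  have ht' : Tri i l j := ht.rot.rot.swap
  have step₆ : ∀ n k, (R n).Symmetric i j l k p 6 → (R (n + 2)).Symmetric i j l k p 7 := by
    intro n k hs
    exact Step.Sends.symmetric ht
      ((T.step n).sends_fst ht (T.negative (n + 1)) k p).2.2.2.2.2.2.1
      ((T.step (n + 1)).sends_snd ht (T.negative (n + 2)) k p).2.2.2.2.2.2.2.2.1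
      ((T.step n).sends_fst ht' (T.negative (n + 1)) k p).2.2.2.2.2.2.1
      ((T.step (n + 1)).sends_snd ht' (T.negative (n + 2)) k p).2.2.2.2.2.2.2.2.1
      (f_six_le i j l k p) (e_six_le i j l k p) hs
  have step₇ : ∀ n k, (R n).Symmetric i j l k p 7 → (R (n + 2)).Symmetric i j l (k + 1) p 6 := by
    intro n k hs
    exact Step.Sends.symmetric ht
      ((T.step n).sends_fst ht (T.negative (n + 1)) k p).2.2.2.2.2.2.2.1
      ((T.step (n + 1)).sends_snd ht (T.negative (n + 2)) k p).2.1
      ((T.step n).sends_fst ht' (T.negative (n + 1)) k p).2.2.2.2.2.2.2.1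
      ((T.step (n + 1)).sends_snd ht' (T.negative (n + 2)) k p).2.1
      (f_seven_le i j l k p) (e_seven_le i j l k p) hs
  induction k with
  | zero =>
    -- For k = 0 the elements are x_i and y_i, which do not involve j and l.
    have h₀ : (R 0).Symmetric i j l 0 p 6 := by
      simp [Model.Symmetric, f_eq, e_eq, N, Q, a_zero, A_zero]
    exact ⟨h₀, step₆ 0 0 h₀⟩
  | succ k ih =>
    have h₁ := step₇ _ k ih.2
    exact ⟨h₁, step₆ _ _ h₁⟩

/-- The elementary maps increase the cumulative elements of a tower. -/
theorem map_le_cum {t : Fin 3} {n : ℕ} {σ : Equiv.Perm (Fin 3)} {r : Fin 14} {k p : ℕ}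
    (hs : (σ, r, k, p) ∈ params t (n + 1)) (d : Fin 3) :
    ((R n).ev (f (σ 0) (σ 1) (σ 2) k p r)).map ((T.step n).φ d) ≤
        (R (n + 1)).ev (cumX t (n + 2)) ∧
      ((R n).ev (e (σ 0) (σ 1) (σ 2) k p r)).map ((T.step n).φ d) ≤
        (R (n + 1)).ev (cumY t (n + 2)) := by
  let S := T.step n
  have hT := tri_perm σ
  have hR := T.negative (n + 1)
  obtain ⟨⟨hkn, hpn⟩, h₀, hr, hlen⟩ := mem_params.1 hs
  have two : ∀ {c c' : Fin 3} {k₁ p₁ k₂ p₂ : ℕ} {r₁ r₂ : Fin 14}, c ≠ c' →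
      S.Sends (σ 0) (σ 1) (σ 2) k p r c k₁ p₁ r₁ → S.Sends (σ 0) (σ 1) (σ 2) k p r c' k₂ p₂ r₂ →
      (σ, r₁, k₁, p₁) ∈ params t (n + 2) → (σ, r₂, k₂, p₂) ∈ params t (n + 2) →
      ((R n).ev (f (σ 0) (σ 1) (σ 2) k p r)).map (S.φ d) ≤
        (R (n + 1)).ev (cumX t (n + 2)) ∧
      ((R n).ev (e (σ 0) (σ 1) (σ 2) k p r)).map (S.φ d) ≤
        (R (n + 1)).ev (cumY t (n + 2)) := fun hc s₁ s₂ m₁ m₂ =>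
    ⟨S.map_le_of_two hc (s₁.le_cum m₁).1 (s₂.le_cum m₂).1 d,
      S.map_le_of_two hc (s₁.le_cum m₁).2 (s₂.le_cum m₂).2 d⟩
  have swapped : ∀ {k₁ p₁ : ℕ} {r₁ : Fin 14}, (R n).Symmetric (σ 0) (σ 1) (σ 2) k p r →
      S.Sends (σ 0) (σ 1) (σ 2) k p r (σ 1) k₁ p₁ r₁ →
      S.Sends (σ 0) (σ 2) (σ 1) k p r (σ 2) k₁ p₁ r₁ →
      (∀ τ : Equiv.Perm (Fin 3), τ 0 = t → (τ, r₁, k₁, p₁) ∈ params t (n + 2)) →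
      ((R n).ev (f (σ 0) (σ 1) (σ 2) k p r)).map (S.φ d) ≤
        (R (n + 1)).ev (cumX t (n + 2)) ∧
      ((R n).ev (e (σ 0) (σ 1) (σ 2) k p r)).map (S.φ d) ≤
        (R (n + 1)).ev (cumY t (n + 2)) := by
    intro k₁ p₁ r₁ hsym s₁ s₂ m
    -- The swapped permutation still starts with t, so its element is a summand of the same
    -- cumulative element; symmetry lets it supply the second map.
    let τ : Equiv.Perm (Fin 3) := σ * Equiv.swap 1 2
    have hτ₀ : τ 0 = σ 0 := by
      rw [show τ 0 = σ (Equiv.swap 1 2 0) from rfl, Equiv.swap_apply_of_ne_of_ne (by decide) (by decide)]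
    have hτ₁ : τ 1 = σ 2 := by simp [τ]
    have hτ₂ : τ 2 = σ 1 := by simp [τ]
    have b₁ := s₁.le_cum (m σ h₀)
    rw [← hτ₀, ← hτ₁, ← hτ₂] at s₂
    have b₂ := s₂.le_cum (m _ (hτ₀.trans h₀))
    rw [hτ₀, hτ₁, hτ₂, ← hsym.1, ← hsym.2] at b₂
    exact ⟨S.map_le_of_two hT.2.1 b₁.1 b₂.1 d, S.map_le_of_two hT.2.1 b₁.2 b₂.2 d⟩
  simp only [mem_params] at two swapped
  by_cases hr6 : r < 6
  · obtain ⟨k, rfl⟩ := Nat.exists_eq_succ_of_ne_zero (hr hr6).ne'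
    obtain ⟨s₀, s₁, s₂, s₃, s₄, s₅, -⟩ := S.sends_fst hT hR k p
    obtain ⟨-, -, u₁, u₂, u₃, u₄, u₅, -⟩ := S.sends_snd hT hR k p
    obtain rfl | rfl | rfl | rfl | rfl | rfl := type_lt_cases hr6 <;> simp [len] at hlen
    · rcases p with - | p
      · exact two hT.2.2.symm s₀ (S.sends_snd hT hR k 0).2.1
          ⟨by omega, h₀, by simp, by simp [len]; omega⟩
          ⟨by omega, h₀, by simp, by simp [len]; omega⟩
      · exact two hT.2.2.symm s₀ (S.sends_snd hT hR k p).1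
          ⟨by omega, h₀, by simp, by simp [len]; omega⟩
          ⟨by omega, h₀, by simp, by simp [len]; omega⟩
    · exact two hT.1 s₁ u₁ ⟨by omega, h₀, by simp, by simp [len]; omega⟩
          ⟨by omega, h₀, by simp, by simp [len]; omega⟩
    · exact two hT.2.1 s₂ u₂ ⟨by omega, h₀, by simp, by simp [len]; omega⟩
          ⟨by omega, h₀, by simp, by simp [len]; omega⟩
    · exact two hT.2.2.symm s₃ u₃ ⟨by omega, h₀, by simp, by simp [len]; omega⟩
          ⟨by omega, h₀, by simp, by simp [len]; omega⟩
    · exact two hT.1 s₄ u₄ ⟨by omega, h₀, by simp, by simp [len]; omega⟩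
          ⟨by omega, h₀, by simp, by simp [len]; omega⟩
    · exact two hT.2.1 s₅ u₅ ⟨by omega, h₀, by simp, by simp [len]; omega⟩
          ⟨by omega, h₀, by simp, by simp [len]; omega⟩
  · obtain ⟨-, -, -, -, -, -, s₆, s₇, s₈, s₉, s₁₀, s₁₁, s₁₂, s₁₃⟩ := S.sends_fst hT hR k p
    obtain ⟨-, -, -, -, -, -, -, -, -, u₉, u₁₀, u₁₁, u₁₂, u₁₃⟩ := S.sends_snd hT hR k p
    obtain ⟨-, -, -, -, -, -, v₆, v₇, -⟩ := S.sends_fst hT.rot.rot.swap hR k p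
    obtain rfl | rfl | rfl | rfl | rfl | rfl | rfl | rfl := type_ge_cases hr6 <;>
      simp [len] at hlen
    -- The length 4k + 1 places the element exactly on the level where its symmetry is known.
    · obtain rfl : n = 4 * k := by omega
      exact swapped (T.symmetric hT k p).1 s₆ v₆
        fun τ hτ => ⟨by omega, hτ, by simp, by simp [len]⟩
    · obtain rfl : n = 4 * k + 2 := by omega
      exact swapped (T.symmetric hT k p).2 s₇ v₇
        fun τ hτ => ⟨by omega, hτ, by simp, by simp [len]; omega⟩
    · rcases p with - | p
      · exact two hT.2.2.symm s₈ (S.sends_snd hT hR k 0).2.2.2.2.2.2.2.2.1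
          ⟨by omega, h₀, by simp, by simp [len]; omega⟩
          ⟨by omega, h₀, by simp, by simp [len]; omega⟩
      · exact two hT.2.2.symm s₈ (S.sends_snd hT hR k p).2.2.2.2.2.2.2.1
          ⟨by omega, h₀, by simp, by simp [len]; omega⟩
          ⟨by omega, h₀, by simp, by simp [len]; omega⟩
    · exact two hT.1 s₉ u₉ ⟨by omega, h₀, by simp, by simp [len]; omega⟩
          ⟨by omega, h₀, by simp, by simp [len]; omega⟩
    · exact two hT.2.1 s₁₀ u₁₀ ⟨by omega, h₀, by simp, by simp [len]; omega⟩
          ⟨by omega, h₀, by simp, by simp [len]; omega⟩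
    · exact two hT.2.2.symm s₁₁ u₁₁ ⟨by omega, h₀, by simp, by simp [len]; omega⟩
          ⟨by omega, h₀, by simp, by simp [len]; omega⟩
    · exact two hT.1 s₁₂ u₁₂ ⟨by omega, h₀, by simp, by simp [len]; omega⟩
          ⟨by omega, h₀, by simp, by simp [len]; omega⟩
    · exact two hT.2.1 s₁₃ u₁₃ ⟨by omega, h₀, by simp, by simp [len]; omega⟩
          ⟨by omega, h₀, by simp, by simp [len]; omega⟩

/-- The images of the elementary maps are the new y_d, and these span the reflected space. -/
theorem eq_top_of_map_le (n : ℕ) {B : Submodule ℚ (R (n + 1)).V}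
    (hB : ∀ d, (⊤ : Submodule ℚ (R n).V).map ((T.step n).φ d) ≤ B) : B = ⊤ := by
  rw [eq_top_iff]
  refine (T.step n).iSup_y.symm.le.trans (iSup_le fun d => ?_)
  rw [← (T.step n).range_eq, LinearMap.range_eq_map]
  exact hB d

theorem cumX_eq_top {t : Fin 3} (n : ℕ) (h₀ : (R 0).ev (cumX t 1) = ⊤) :
    (R n).ev (cumX t (n + 1)) = ⊤ := by
  induction n with
  | zero => exact h₀
  | succ n ih =>
    refine T.eq_top_of_map_le n fun d => ?_
    rw [← ih, cumX, (T.negative n).ev_finset_sup, Submodule.map_le_iff_le_comap]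
    refine Finset.sup_le ?_
    rintro ⟨σ, r, k, p⟩ hs
    exact Submodule.map_le_iff_le_comap.1 (T.map_le_cum hs d).1

theorem cumY_eq_top {t : Fin 3} (n : ℕ) (h₀ : (R 0).ev (cumY t 1) = ⊤) :
    (R n).ev (cumY t (n + 1)) = ⊤ := by
  induction n with
  | zero => exact h₀
  | succ n ih =>
    refine T.eq_top_of_map_le n fun d => ?_
    rw [← ih, cumY, (T.negative n).ev_finset_sup, Submodule.map_le_iff_le_comap]
    refine Finset.sup_le ?_
    rintro ⟨σ, r, k, p⟩ hs
    exact Submodule.map_le_iff_le_comap.1 (T.map_le_cum hs d).2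

theorem cumX_eq_bot {t : Fin 3} {m : ℕ} (hm : 1 ≤ m) (h₀ : (R 0).ev (cumX t m) = ⊥) (n : ℕ) :
    (R n).ev (cumX t (n + m)) = ⊥ := by
  induction n with
  | zero => rwa [zero_add]
  | succ n ih =>
    rw [Nat.add_right_comm]
    exact (T.step _).cumX_eq_bot (T.negative n) (T.negative (n + 1)) (by omega) ih

theorem cumY_eq_bot {t : Fin 3} {m : ℕ} (hm : 1 ≤ m) (h₀ : (R 0).ev (cumY t m) = ⊥) (n : ℕ) :
    (R n).ev (cumY t (n + m)) = ⊥ := by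
  induction n with
  | zero => rwa [zero_add]
  | succ n ih =>
    rw [Nat.add_right_comm]
    exact (T.step n).cumY_eq_bot (T.negative n) (T.negative (n + 1)) (by omega) ih

/-- The elements `x_t(n)` vanish on the `n`-th reflection if `y_t` vanishes. -/
theorem cumX_self_eq_bot {t : Fin 3} (h₀ : (R 0).y t = ⊥) (n : ℕ) :
    (R n).ev (cumX t n) = ⊥ := by
  induction n with
  | zero => rw [cumX_zero]; exact (T.negative 0).ev_bot
  | succ n ih =>
    -- Propagation starts only at length 1, so this first value comes from x_t being the image of
    -- y_t = 0.
    rcases n with - | n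
    · rw [cumX_one]
      refine ((T.step 0).map_y t).symm.trans ?_
      rw [h₀, Submodule.map_bot]
    · exact (T.step _).cumX_eq_bot (T.negative _) (T.negative _) (by omega) ih

end Tower

theorem add_one_ne (i : Fin 3) : i + 1 ≠ i := by revert i; decide

theorem add_two_ne (i : Fin 3) : i + 2 ≠ i := by revert i; decide

/-! ### Projective representations -/

/-- The one-dimensional representation in which `y_c` is the whole space, as is `x_c` if `b`, and
the other subspaces vanish. -/
def line (c : Fin 3) (b : Bool) : Model where
  V := ℚ
  x i := if i = c ∧ b = true then ⊤ else ⊥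
  y i := if i = c then ⊤ else ⊥
  le i := by
    by_cases h : i = c <;> simp [h]

theorem line_x (c i : Fin 3) (b : Bool) :
    (line c b).x i = if i = c ∧ b = true then ⊤ else ⊥ := rfl

theorem line_y (c i : Fin 3) (b : Bool) : (line c b).y i = if i = c then ⊤ else ⊥ := rfl

theorem line_negative (c : Fin 3) (b : Bool) : (line c b).Negative where
  finite := inferInstanceAs (Module.Finite ℚ ℚ)
  nontrivial := inferInstanceAs (Nontrivial ℚ)
  defect U hU := by
    have hfin : Module.Finite ℚ (line c b).V := inferInstanceAs (Module.Finite ℚ ℚ)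
    have hpos : 0 < Module.finrank ℚ U :=
      Nat.pos_of_ne_zero fun h0 => hU (Submodule.finrank_eq_zero.1 h0)
    have hle : ∀ i, Module.finrank ℚ ↥((line c b).x i ⊓ U) +
        Module.finrank ℚ ↥((line c b).y i ⊓ U) ≤ if i = c then 2 * Module.finrank ℚ U else 0 := by
      intro i
      by_cases hi : i = c
      · rw [if_pos hi, two_mul]
        exact add_le_add (Submodule.finrank_mono inf_le_right) (Submodule.finrank_mono inf_le_right)
      · rw [line_x, line_y, if_neg hi, if_neg (fun h => hi h.1), if_neg hi, bot_inf_eq]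
        simp
    refine (Finset.sum_le_sum fun i _ => hle i).trans_lt ?_
    rw [Finset.sum_ite_eq' Finset.univ c, if_pos (Finset.mem_univ c)]
    omega

section Line

variable (c : Fin 3) (b : Bool)

/-- The reflections of a one-dimensional representation. -/
abbrev lines (n : ℕ) : Model := (line c b).tower n

theorem linesTower : Nonempty (Tower (lines c b)) := ⟨(line_negative c b).toTower⟩

theorem lines_bot_ne_top (n : ℕ) : (⊥ : Submodule ℚ (lines c b n).V) ≠ ⊤ := by
  have := ((line_negative c b).tower n).nontrivial
  exact bot_ne_top

variable {c} {b}

theorem lines_cumX {t : Fin 3} (ht : t ≠ c) (n : ℕ) : (lines c b n).ev (cumX t n) = ⊥ := by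
  obtain ⟨T⟩ := linesTower c b
  exact T.cumX_self_eq_bot (if_neg ht) n

theorem lines_cumY {t : Fin 3} (ht : t ≠ c) (n : ℕ) : (lines c b n).ev (cumY t (n + 1)) = ⊥ := by
  obtain ⟨T⟩ := linesTower c b
  exact T.cumY_eq_bot le_rfl (by rw [cumY_one]; exact if_neg ht) n

theorem lines_cumX_succ {t : Fin 3} (ht : t ≠ c) (n : ℕ) :
    (lines c b n).ev (cumX t (n + 1)) = ⊥ :=
  le_bot_iff.1 (((lines c b n).ev_mono (cumX_le_cumY t _)).trans (lines_cumY ht n).le)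

/-- The elements e_α of length two are y_j (x_i + y_l), which vanish on a line where only the index
c carries anything. -/
theorem lines_cumY_two (t : Fin 3) (n : ℕ) : (lines c b n).ev (cumY t (n + 2)) = ⊥ := by
  obtain ⟨T⟩ := linesTower c b
  refine T.cumY_eq_bot (by omega) ?_ n
  rw [cumY, (T.negative 0).ev_finset_sup, Finset.sup_eq_bot_iff]
  rintro ⟨σ, r, k, p⟩ hs
  obtain ⟨rfl, rfl, rfl⟩ := eq_of_mem_params_two hs
  have h := tri_perm σ
  change (line c b).ev (e (σ 0) (σ 1) (σ 2) 0 0 8) = ⊥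
  have he : e (σ 0) (σ 1) (σ 2) 0 0 8 = y (σ 1) ⊓ (x (σ 0) ⊔ y (σ 2)) := by
    simp [e_eq, P, a_zero, A_zero, a_succ h.rot.rot.swap]
  rw [he, Model.ev_inf, Model.ev_sup, Model.ev_y, Model.ev_x, Model.ev_y, line_x, line_y, line_y]
  by_cases h₁ : σ 1 = c
  · have h₀ : ¬ (σ 0 = c ∧ b = true) := fun h' => h.1 (h'.1.trans h₁.symm)
    have h₂ : σ 2 ≠ c := fun h' => h.2.1 (h₁.trans h'.symm)
    rw [if_neg h₀, if_neg h₂, sup_bot_eq, inf_bot_eq]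
  · rw [if_neg h₁, bot_inf_eq]

theorem lines_cumY_self (n : ℕ) : (lines c b n).ev (cumY c (n + 1)) = ⊤ := by
  obtain ⟨T⟩ := linesTower c b
  exact T.cumY_eq_top n (by rw [cumY_one]; exact if_pos rfl)

theorem lines_cumX_self (n : ℕ) : (lines c true n).ev (cumX c (n + 1)) = ⊤ := by
  obtain ⟨T⟩ := linesTower c true
  exact T.cumX_eq_top n (by rw [cumX_one]; exact if_pos ⟨rfl, rfl⟩)

theorem lines_cumX_false (n : ℕ) : (lines c false n).ev (cumX c (n + 1)) = ⊥ := by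
  obtain ⟨T⟩ := linesTower c false
  exact T.cumX_eq_bot le_rfl (by rw [cumX_one]; exact if_neg fun h => Bool.noConfusion h.2) n

theorem lines_genA (n : ℕ) : (lines c b n).ev (genA n c) = ⊥ := by
  have h₁ := add_one_ne c
  have h₂ := add_two_ne c
  simp only [genA_eq, Model.ev_sup, lines_cumX h₁, lines_cumX h₂, lines_cumY h₁, lines_cumY h₂,
    bot_sup_eq]

end Line

/-! ### The chains -/

theorem genA_lt_genB (n : ℕ) (i : Fin 3) : genA n i < genB n i := by
  refine lt_of_le_of_ne (genB_eq n i ▸ le_sup_left) fun h => lines_bot_ne_top i true n ?_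
  rw [← lines_genA, h, genB_eq, Model.ev_sup, lines_cumX_self, sup_top_eq]

theorem genB_lt_genC (n : ℕ) (i : Fin 3) : genB n i < genC n i := by
  refine lt_of_le_of_ne ?_ fun h => lines_bot_ne_top i false n ?_
  · rw [genB_eq, genC_eq]
    exact sup_le_sup_left (cumX_le_cumY _ _) _
  · have h₁ : (lines i false n).ev (genB n i) = ⊥ := by
      rw [genB_eq, Model.ev_sup, lines_genA, lines_cumX_false, sup_bot_eq]
    rw [← h₁, h, genC_eq, Model.ev_sup, lines_cumY_self, sup_top_eq]

theorem genA_le_unit (n : ℕ) (i : Fin 3) : genA n i ≤ unit n := by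
  fin_cases i
  · exact le_sup_left.trans le_sup_left
  · exact le_sup_right.trans le_sup_left
  · exact le_sup_right

theorem cum_le_genA {n : ℕ} {i t : Fin 3} (h : t ≠ i) :
    cumX t n ⊔ cumY t (n + 1) ≤ genA n i := by
  have ht : t = i + 1 ∨ t = i + 2 := by revert t i; decide
  rw [genA_eq]
  rcases ht with rfl | rfl
  · exact sup_le (le_sup_left.trans (le_sup_left.trans le_sup_left))
      (le_sup_right.trans le_sup_left)
  · exact sup_le (le_sup_right.trans (le_sup_left.trans le_sup_left)) le_sup_right

theorem genA_le_of_cum_le {n : ℕ} {i : Fin 3} {z : D222}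
    (h : ∀ t, t ≠ i → cumX t n ⊔ cumY t (n + 1) ≤ z) : genA n i ≤ z := by
  have h₁ := h (i + 1) (add_one_ne i)
  have h₂ := h (i + 2) (add_two_ne i)
  rw [genA_eq]
  exact sup_le (sup_le (sup_le (le_sup_left.trans h₁) (le_sup_left.trans h₂))
    (le_sup_right.trans h₁)) (le_sup_right.trans h₂)

theorem cum_le_unit (n : ℕ) (t : Fin 3) : cumX t n ⊔ cumY t (n + 1) ≤ unit n :=
  (cum_le_genA (add_one_ne t).symm).trans (genA_le_unit n _)

/-- Summands of index other than i lie in a_i, and those of index i lie in both a_j and a_l. -/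
theorem genA_sup_inf {i j l : Fin 3} (h : Tri i j l) (n : ℕ) :
    genA n i ⊔ genA n j ⊓ genA n l = unit n := by
  refine le_antisymm (sup_le (genA_le_unit n i) (inf_le_left.trans (genA_le_unit n j))) ?_
  have hle : ∀ t, cumX t n ⊔ cumY t (n + 1) ≤ genA n i ⊔ genA n j ⊓ genA n l := by
    intro t
    rcases eq_or_ne t i with rfl | ht
    · exact le_sup_of_le_right (le_inf (cum_le_genA h.1) (cum_le_genA h.2.2))
    · exact le_sup_of_le_left (cum_le_genA ht)
  exact sup_le (sup_le (genA_le_of_cum_le fun t _ => hle t) (genA_le_of_cum_le fun t _ => hle t))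
    (genA_le_of_cum_le fun t _ => hle t)

/-- Only n reflections are taken: at that stage x_i(n+1), a summand of I_{n+1}, is everything, while
c_i(n+1) involves only vanishing terms. -/
theorem genC_lt_unit (n : ℕ) (i : Fin 3) : genC (n + 1) i < unit (n + 1) := by
  refine lt_of_le_of_ne ?_ fun h => lines_bot_ne_top i true n ?_
  · rw [genC_eq]
    exact sup_le (genA_le_unit _ i) (le_sup_right.trans (cum_le_unit _ i))
  · have h₁ := add_one_ne i
    have h₂ := add_two_ne i
    have h₃ : (lines i true n).ev (genC (n + 1) i) = ⊥ := by
      simp only [genC_eq, genA_eq, Model.ev_sup, lines_cumX_succ h₁, lines_cumX_succ h₂,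
        lines_cumY_two, bot_sup_eq]
    rw [← h₃, h, eq_top_iff, ← lines_cumX_self]
    exact Model.ev_mono _ (le_sup_left.trans (cum_le_unit _ i))

theorem genC_zero (i : Fin 3) : genC 0 i = unit 0 := by
  change y 0 ⊔ y 1 ⊔ y 2 = (y 1 ⊔ y 2) ⊔ (y 2 ⊔ y 0) ⊔ (y 0 ⊔ y 1)
  refine le_antisymm (sup_le (sup_le ?_ ?_) ?_) (sup_le (sup_le (sup_le ?_ ?_) (sup_le ?_ ?_))
    (sup_le ?_ ?_))
  · exact le_sup_left.trans le_sup_right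
  · exact le_sup_right.trans le_sup_right
  · exact le_sup_right.trans (le_sup_left.trans le_sup_left)
  · exact le_sup_right.trans le_sup_left
  · exact le_sup_right
  · exact le_sup_right
  · exact le_sup_left.trans le_sup_left
  · exact le_sup_left.trans le_sup_left
  · exact le_sup_right.trans le_sup_left

theorem tri_zero_one_two : Tri 0 1 2 := by unfold Tri; decide

theorem chain4_strictMono (n : ℕ) (i : Fin 3) : StrictMono (chain4 (n + 1) i) := by
  rw [Fin.strictMono_iff_lt_succ]
  intro s
  fin_cases s
  · exact genA_lt_genB (n + 1) i
  · exact genB_lt_genC (n + 1) i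
  · exact genC_lt_unit n i

theorem chain3_strictMono (i : Fin 3) : StrictMono (chain3 i) := by
  rw [Fin.strictMono_iff_lt_succ]
  intro s
  fin_cases s
  · exact genA_lt_genB 0 i
  · exact genB_lt_genC 0 i

theorem coindependentChains_chain4 (n : ℕ) :
    CoindependentChains (chain4 (n + 1)) (unit (n + 1)) where
  mono := chain4_strictMono n
  last _ := rfl
  sup₀ := genA_sup_inf tri_zero_one_two (n + 1)
  sup₁ := genA_sup_inf tri_zero_one_two.swap (n + 1)
  sup₂ := genA_sup_inf tri_zero_one_two.rot.rot (n + 1)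

theorem coindependentChains_chain3 : CoindependentChains chain3 (unit 0) where
  mono := chain3_strictMono
  last i := genC_zero i
  sup₀ := genA_sup_inf tri_zero_one_two 0
  sup₁ := genA_sup_inf tri_zero_one_two.swap 0
  sup₂ := genA_sup_inf tri_zero_one_two.rot.rot 0

/-! ### The generated sublattices -/

theorem subset_gen (S : Set D222) {z : D222} (hz : z ∈ S) : z ∈ gen S :=
  subset_latticeClosure hz

theorem gen_le {S : Set D222} {S' : Sublattice D222} (h : ∀ z ∈ S, z ∈ S') : gen S ≤ S' :=
  latticeClosure_min h S'.isSublattice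

theorem unit_mem {n : ℕ} {S : Sublattice D222} (h : ∀ i, genA n i ∈ S) : unit n ∈ S :=
  S.supClosed (S.supClosed (h 0) (h 1)) (h 2)

theorem exists_orderIso_H_succ (n : ℕ) :
    ∃ φ : (Fin 3 → Fin 4) ≃o H (n + 1), ∀ v : Fin 3 → Fin 4, (φ v : D222) =
      chain4 (n + 1) 0 (v 0) ⊓ chain4 (n + 1) 1 (v 1) ⊓ chain4 (n + 1) 2 (v 2) := by
  refine (coindependentChains_chain4 n).exists_orderIso _ ?_ ?_
  · have hA : ∀ i, genA (n + 1) i ∈ H (n + 1) := fun i =>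
      subset_gen _ (.inl (.inl ⟨i, rfl⟩))
    intro i s
    fin_cases s
    · exact hA i
    · exact subset_gen _ (.inl (.inr ⟨i, rfl⟩))
    · exact subset_gen _ (.inr ⟨i, rfl⟩)
    · exact unit_mem hA
  · intro S' h
    refine gen_le ?_
    rintro _ ((⟨i, rfl⟩ | ⟨i, rfl⟩) | ⟨i, rfl⟩)
    exacts [h i 0, h i 1, h i 2]

theorem exists_orderIso_H_zero :
    ∃ φ : (Fin 3 → Fin 3) ≃o H 0, ∀ v : Fin 3 → Fin 3, (φ v : D222) =
      chain3 0 (v 0) ⊓ chain3 1 (v 1) ⊓ chain3 2 (v 2) := by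
  refine coindependentChains_chain3.exists_orderIso _ ?_ ?_
  · have hA : ∀ i, genA 0 i ∈ H 0 := fun i => subset_gen _ (.inl ⟨i, rfl⟩)
    intro i s
    fin_cases s
    · exact hA i
    · exact subset_gen _ (.inr ⟨i, rfl⟩)
    · have hC : genC 0 i ∈ H 0 := (genC_zero i).symm ▸ unit_mem hA
      exact hC
  · intro S' h
    refine gen_le ?_
    rintro _ (⟨i, rfl⟩ | ⟨i, rfl⟩)
    exacts [h i 0, h i 1]

theorem inf_sup_left_of_orderIso {L L' : Type*} [DistribLattice L] [Lattice L'] (φ : L ≃o L')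
    (u v w : L') : u ⊓ (v ⊔ w) = (u ⊓ v) ⊔ (u ⊓ w) := by
  apply φ.symm.injective
  simp only [map_inf, map_sup, inf_sup_left]

end D222

theorem mainTheorem4 :
    (∀ (n : ℕ) (u v w : D222.H n), u ⊓ (v ⊔ w) = (u ⊓ v) ⊔ (u ⊓ w)) ∧
    (∀ n : ℕ, 1 ≤ n →
      Nat.card (D222.H n) = 64 ∧
      (∀ i, StrictMono (D222.chain4 n i)) ∧
      ∃ φ : (Fin 3 → Fin 4) ≃o D222.H n, ∀ v : Fin 3 → Fin 4,
        (φ v : D222) =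
          D222.chain4 n 0 (v 0) ⊓ D222.chain4 n 1 (v 1) ⊓ D222.chain4 n 2 (v 2)) ∧
    (Nat.card (D222.H 0) = 27 ∧
      (∀ i, StrictMono (D222.chain3 i)) ∧
      ∃ φ : (Fin 3 → Fin 3) ≃o D222.H 0, ∀ v : Fin 3 → Fin 3,
        (φ v : D222) =
          D222.chain3 0 (v 0) ⊓ D222.chain3 1 (v 1) ⊓ D222.chain3 2 (v 2)) := by
  refine ⟨fun n u v w => ?_, fun n hn => ?_, ?_, D222.chain3_strictMono,
    D222.exists_orderIso_H_zero⟩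
  · rcases n with - | n
    · obtain ⟨φ, -⟩ := D222.exists_orderIso_H_zero
      exact D222.inf_sup_left_of_orderIso φ u v w
    · obtain ⟨φ, -⟩ := D222.exists_orderIso_H_succ n
      exact D222.inf_sup_left_of_orderIso φ u v w
  · obtain ⟨n, rfl⟩ := Nat.exists_eq_succ_of_ne_zero (show n ≠ 0 by omega)
    refine ⟨?_, D222.chain4_strictMono n, D222.exists_orderIso_H_succ n⟩
    obtain ⟨φ, -⟩ := D222.exists_orderIso_H_succ n
    rw [← Nat.card_congr φ.toEquiv]
    simp
  · obtain ⟨φ, -⟩ := D222.exists_orderIso_H_zero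
    rw [← Nat.card_congr φ.toEquiv]
    simp
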